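/- **Theorem (unisolvence for 2-forms on the pentatope).** Let $K\subset\mathbb{R}^4$ be a pentatope, i.e. the convex hull of five affinely independent points (for instance the reference pentatope, or the one with vertices $0,e_1,e_2,e_3,e_4$), and let $k\ge 1$. Let $P^m$ denote the real polynomials of degree at most $m$ (so $P^m=0$ for $m<0$), and $\tilde P^m$ the homogeneous polynomials of degree exactly $m$. Let $\mathcal{L}$ be the linear bijection sending $(w_{12},w_{13},w_{14},w_{23},w_{24},w_{34})$ to the skew-symmetric $4\times4$ matrix with these entries above the diagonal. Put $$V^{k,2}(K)=\mathcal{L}\big((P^{k-1})^6\big)\oplus\big(\tilde P^{k-1}B_1+\tilde P^{k-1}B_2+\tilde P^{k-1}B_3+\tilde P^{k-1}B_4\big),$$ where $$B_1=\mathcal{L}(0,0,0,x_4,-x_3,x_2),\quad B_2=\mathcal{L}(0,-x_4,x_3,0,0,-x_1),$$ $$B_3=\mathcal{L}(x_4,0,-x_2,0,x_1,0),\quad B_4=\mathcal{L}(-x_3,x_2,0,-x_1,0,0).$$ For a facet $\mathcal{F}$ of $K$ with unit normal $n$, the trace of $F$ on $\mathcal{F}$ is the tangential vector field $\mathrm{Tr}(F)=n\times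 F$ with components $(n\times F)_i=\sum_{j,k,l}\varepsilon_{ijkl}\,n_jF_{kl}$. The degrees of freedom $\Sigma^{k,2}(K)$ of $F$ are * $\int_f(\mathrm{Tr}(F)\cdot\nu)\,q$, $q\in P^{k-1}(f)$, for each of the ten triangular faces $f$, where the trace is taken on a facet containing $f$ and $\nu$ is a unit vector tangent to that facet and normal to $f$; * $\int_{\mathcal{F}}\mathrm{Tr}(F)\cdot q$, $q\in(P^{k-2}(\mathcal{F}))^3$ (tangential polynomial fields of degree at most $k-2$), for each of the five tetrahedral facets $\mathcal{F}$; * $\int_K F:q$, $q\in\mathcal{L}\big((P^{k-3}(K))^6\big)$. For every choice of the unit normals and of the facets containing the faces, the following hold. If $F\in V^{k,2}(K)$ and all the degrees of freedom $\Sigma^{k,2}(K)$ of $F$ vanish, then $F\equiv0$. Moreover, the degrees of freedom are unisolvent: for arbitrarily prescribed linear functionals on the test spaces $P^{k-1}(f)$ (one for each face), $(P^{k-2}(\mathcal{F}))^3$ (one for each facet) and $\mathcal{L}((P^{k-3}(K))^6)$, there is exactly one $F\in V^{k,2}(K)$ whose face, facet and volume moments are given by these functionals. -/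

import Mathlib

namespace Pentatope

open MvPolynomial Matrix

noncomputable section

/-- `P^m`: real polynomials in `d` variables of degree at most `m`. The bound is an integer, so
that `P^m = 0` for negative `m`. -/
def polySpace (d : ℕ) (m : ℤ) : Submodule ℝ (MvPolynomial (Fin d) ℝ) :=
  restrictSupport ℝ {α | (α.degree : ℤ) ≤ m}

/-- Homogeneous real polynomials in `d` variables of degree exactly `m` (and `0`). -/
def homogSpace (d : ℕ) (m : ℤ) : Submodule ℝ (MvPolynomial (Fin d) ℝ) :=
  restrictSupport ℝ {α | (α.degree : ℤ) = m}

/-- Polynomial `4 × 4` matrix fields on `ℝ⁴`. -/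
abbrev MatrixField := Matrix (Fin 4) (Fin 4) (MvPolynomial (Fin 4) ℝ)

/-- The value of a polynomial matrix field at a point. -/
def evalField (F : MatrixField) (x : Fin 4 → ℝ) : Matrix (Fin 4) (Fin 4) ℝ :=
  F.map (eval x)

/-- The map `𝓛` from 6-vectors `(w₁₂, w₁₃, w₁₄, w₂₃, w₂₄, w₃₄)` of polynomials to
skew-symmetric matrices. -/
def skew : (Fin 6 → MvPolynomial (Fin 4) ℝ) →ₗ[ℝ] MatrixField where
  toFun w := !![0, w 0, w 1, w 2;
    -w 0, 0, w 3, w 4;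
    -w 1, -w 3, 0, w 5;
    -w 2, -w 4, -w 5, 0]
  map_add' w z := by
    ext i j : 2
    fin_cases i <;> fin_cases j <;> simp <;> ring
  map_smul' c w := by
    ext i j : 2
    fin_cases i <;> fin_cases j <;> simp

/-- The matrices `B₁, B₂, B₃, B₄`. The variables `x₁, …, x₄` are `X 0, …, X 3`. -/
def B : Fin 4 → MatrixField := ![
  !![0, 0, 0, 0;
    0, 0, X 3, -X 2;
    0, -X 3, 0, X 1;
    0, X 2, -X 1, 0],
  !![0, 0, -X 3, X 2;
    0, 0, 0, 0;
    X 3, 0, 0, -X 0;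
    -X 2, 0, X 0, 0],
  !![0, X 3, 0, -X 1;
    -X 3, 0, 0, X 0;
    0, 0, 0, 0;
    X 1, -X 0, 0, 0],
  !![0, -X 2, X 1, 0;
    X 2, 0, -X 0, 0;
    -X 1, X 0, 0, 0;
    0, 0, 0, 0]]

/-- Multiplication of a fixed matrix field by a scalar polynomial: `p ↦ p A`. -/
def mulField (A : MatrixField) : MvPolynomial (Fin 4) ℝ →ₗ[ℝ] MatrixField :=
  (LinearMap.toSpanSingleton (MvPolynomial (Fin 4) ℝ) MatrixField A).restrictScalars ℝ

/-- The space `V^{k,2}` of polynomial 2-form proxies: the sum of `𝓛((P^{k-1})⁶)` and the span of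
the products `p Bᵢ` with `p` homogeneous of degree `k - 1`. -/
def twoFormSpace (k : ℕ) : Submodule ℝ MatrixField :=
  (Submodule.pi Set.univ fun _ : Fin 6 => polySpace 4 ((k : ℤ) - 1)).map skew ⊔
    ⨆ i : Fin 4, (homogSpace 4 ((k : ℤ) - 1)).map (mulField (B i))

/-- The Levi-Civita symbol, as the determinant with rows `eᵢ, eⱼ, eₖ, eₗ`. -/
def leviCivita (i j k l : Fin 4) : ℝ :=
  Matrix.det (Matrix.of fun a b : Fin 4 => if ![i, j, k, l] a = b then (1 : ℝ) else 0)

/-- The cross product `M × U` of a 4-vector and a `4 × 4` matrix. -/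
def cross (M : Fin 4 → ℝ) (U : Matrix (Fin 4) (Fin 4) ℝ) : Fin 4 → ℝ :=
  fun i => ∑ j, ∑ k, ∑ l, leviCivita i j k l * M j * U k l

/-- The `d`-dimensional subsimplices of a pentatope, given by increasing lists of `d + 1` of its
five vertices: ten faces (`d = 2`) and five facets (`d = 3`). -/
abbrev Sub (d : ℕ) := Fin (d + 1) ↪o Fin 5

/-- The edge vectors `p_{a+1} - p₀` of the simplex with vertices `p`. -/
def edge {d : ℕ} (p : Fin (d + 1) → Fin 4 → ℝ) (a : Fin d) : Fin 4 → ℝ :=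
  p a.succ - p 0

/-- The affine coordinates `s ↦ p₀ + ∑ sₐ (p_{a+1} - p₀)` on the simplex with vertices `p`. -/
def param {d : ℕ} (p : Fin (d + 1) → Fin 4 → ℝ) (s : Fin d → ℝ) : Fin 4 → ℝ :=
  p 0 + ∑ a, s a • edge p a

/-- The parameter domain `{s | sₐ ≥ 0, ∑ sₐ ≤ 1}`. -/
def unitSimplex (d : ℕ) : Set (Fin d → ℝ) :=
  {s | (∀ a, 0 ≤ s a) ∧ ∑ a, s a ≤ 1}

/-- The integral, with respect to `d`-dimensional surface measure, over the `d`-simplex with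
vertices `p` of a function `h` written in the affine coordinates `s` of that simplex; the
surface element is the square root of the Gram determinant of the edge vectors. -/
def simplexIntegral {d : ℕ} (p : Fin (d + 1) → Fin 4 → ℝ) (h : (Fin d → ℝ) → ℝ) : ℝ :=
  Real.sqrt (Matrix.det (Matrix.of fun a b => edge p a ⬝ᵥ edge p b)) *
    ∫ s in unitSimplex d, h s

/-- A choice of unit normals for the pentatope with vertices `v`: a unit normal `n 𝓕` to each
facet `𝓕` in `ℝ⁴`, and, for each face `f`, a facet containing `f` together with a unit vector
`ν f` tangent to that facet and normal to `f`. -/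
structure UnitNormals (v : Fin 5 → Fin 4 → ℝ) where
  n : Sub 3 → Fin 4 → ℝ
  n_unit : ∀ 𝓕, n 𝓕 ⬝ᵥ n 𝓕 = 1
  n_normal : ∀ (𝓕 : Sub 3) (a b : Fin 4), n 𝓕 ⬝ᵥ (v (𝓕 a) - v (𝓕 b)) = 0
  facet : Sub 2 → Sub 3
  face_subset : ∀ f : Sub 2, Set.range f ⊆ Set.range (facet f)
  ν : Sub 2 → Fin 4 → ℝ
  ν_unit : ∀ f, ν f ⬝ᵥ ν f = 1
  ν_normal : ∀ (f : Sub 2) (a b : Fin 3), ν f ⬝ᵥ (v (f a) - v (f b)) = 0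
  ν_tangent : ∀ f, ν f ⬝ᵥ n (facet f) = 0

/-- The face moment `∫_f (Tr F · ν) q`, where the trace of `F` on a facet with unit normal `n` is
`n × F`, a vector tangent to that facet. The test function `q` is written in the affine
coordinates of `f`. -/
def faceMoment {v : Fin 5 → Fin 4 → ℝ} (N : UnitNormals v) (f : Sub 2)
    (F : MatrixField) (q : MvPolynomial (Fin 2) ℝ) : ℝ :=
  simplexIntegral (v ∘ f) fun s =>
    (cross (N.n (N.facet f)) (evalField F (param (v ∘ f) s)) ⬝ᵥ N.ν f) * eval s q

/-- The facet moment `∫_𝓕 Tr F · q`. The test function `q` is the tangential vector field on `𝓕`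
with components `q a` along the edge vectors, written in the affine coordinates of `𝓕`. -/
def facetMoment {v : Fin 5 → Fin 4 → ℝ} (N : UnitNormals v) (𝓕 : Sub 3)
    (F : MatrixField) (q : Fin 3 → MvPolynomial (Fin 3) ℝ) : ℝ :=
  simplexIntegral (v ∘ 𝓕) fun s =>
    cross (N.n 𝓕) (evalField F (param (v ∘ 𝓕) s)) ⬝ᵥ
      ∑ a, eval s (q a) • edge (v ∘ 𝓕) a

/-- The volume moment `∫_K F : 𝓛(w)` over the pentatope `K` with vertices `v`. -/
def volumeMoment (v : Fin 5 → Fin 4 → ℝ) (F : MatrixField)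
    (w : Fin 6 → MvPolynomial (Fin 4) ℝ) : ℝ :=
  ∫ x in convexHull ℝ (Set.range v),
    ∑ i, ∑ j, evalField F x i j * evalField (skew w) x i j

end

end Pentatope

open MvPolynomial Matrix MeasureTheory
open scoped Pointwise

namespace Pentatope

noncomputable section

/-! ### Integration of polynomials over the unit simplex -/

/-! The space $V^{k,2}$ lies in the trimmed 2-forms: skew fields of degree at most $k$ whose
contraction with the position vector $x$ also has degree at most $k$
(`twoFormSpace_le_trimmedSpace`). This condition survives affine pullback (`IsTrimmed.pull`), so one
statement can be applied on triangles, tetrahedra and the pentatope, each written in affine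
coordinates on the unit simplex.

That statement is `IsTrimmed.eq_zero`: on the $d$-simplex, a trimmed form $G$ with zero trace on the
facets and zero moments against polynomials of degree at most $k+1-d$ is zero. Zero trace makes
$(dG)_{abc}$ divisible by the product of the other $d-3$ variables, with cofactor $w$ of degree at
most $k+2-d$. Stokes against $w$ moves the derivatives onto $w$, where the moments annihilate them.
Hence the integral of $(\prod x_e)w^2$ is zero and $dG=0$. Cartan's formula $L_xG=d(i_xG)$ then
lowers the degree of $G$ to $k-1$. Each $G_{ab}$ is the product of the other $d-2$ variables with a
cofactor of degree at most $k+1-d$, which is itself an admissible test function, so the same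
positivity gives $G=0$.

On edges every 2-form vanishes. Dimensions 2, 3 and 4 require moments of degree $k-1$, $k-2$ and
$k-3$, which are exactly the prescribed ones once each moment is written through the pullback
(`exists_faceMoment_eq`, `exists_facetMoment_eq`, `exists_volumeMoment_eq`).

The moment map is therefore injective. Bijectivity is a dimension count: Koszul exactness bounds the
dimension of $V^{k,2}$ below by an upper bound for the number of moments. -/

lemma isCompact_unitSimplex (d : ℕ) : IsCompact (unitSimplex d) := by
  refine Metric.isCompact_of_isClosed_isBounded ?_ ?_
  · have h : unitSimplex d = (⋂ a, {s | 0 ≤ s a}) ∩ {s | ∑ a, s a ≤ 1} := by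
      ext s; simp [unitSimplex]
    rw [h]
    exact (isClosed_iInter fun a => isClosed_le (by fun_prop) (by fun_prop)).inter
      (isClosed_le (by fun_prop) (by fun_prop))
  · refine (Metric.isBounded_Icc (0 : Fin d → ℝ) 1).subset fun s hs => ⟨hs.1, fun a => ?_⟩
    exact (Finset.single_le_sum (fun b _ => hs.1 b) (Finset.mem_univ a)).trans hs.2

lemma measurableSet_unitSimplex (d : ℕ) : MeasurableSet (unitSimplex d) :=
  (isCompact_unitSimplex d).measurableSet

lemma continuous_eval_mvPolynomial {d : ℕ} (p : MvPolynomial (Fin d) ℝ) :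
    Continuous fun s => eval s p :=
  MvPolynomial.continuous_eval p

lemma integrableOn_unitSimplex {d : ℕ} {f : (Fin d → ℝ) → ℝ} (hf : Continuous f) :
    IntegrableOn f (unitSimplex d) :=
  hf.continuousOn.integrableOn_compact (isCompact_unitSimplex d)

/-- The integral of a polynomial over the unit simplex, as a linear functional. -/
def polyIntegral (d : ℕ) : MvPolynomial (Fin d) ℝ →ₗ[ℝ] ℝ where
  toFun p := ∫ s in unitSimplex d, eval s p
  map_add' p q := by
    simp only [map_add]
    exact integral_add (integrableOn_unitSimplex (continuous_eval_mvPolynomial p))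
      (integrableOn_unitSimplex (continuous_eval_mvPolynomial q))
  map_smul' c p := by
    simp only [smul_eval, RingHom.id_apply, smul_eq_mul]
    exact integral_const_mul c _

lemma polyIntegral_apply {d : ℕ} (p : MvPolynomial (Fin d) ℝ) :
    polyIntegral d p = ∫ s in unitSimplex d, eval s p := rfl

/-- Integration by parts lowers the exponent of $1-t$ and raises that of $t$, so the induction on
`b` must keep `a` universally quantified. -/
lemma integral_pow_mul_one_sub_pow (b : ℕ) : ∀ a : ℕ,
    ∫ t in (0 : ℝ)..1, t ^ a * (1 - t) ^ b =
      (a.factorial * b.factorial : ℝ) / ((a + b + 1).factorial : ℝ) := by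
  induction b with
  | zero =>
    intro a
    simp [integral_pow, Nat.factorial_succ]
    field_simp
  | succ b ih =>
    intro a
    have h : ∫ t in (0 : ℝ)..1, ((a + 1 : ℝ) * (t ^ a * (1 - t) ^ (b + 1)) -
        (b + 1 : ℝ) * (t ^ (a + 1) * (1 - t) ^ b)) = 0 := by
      rw [intervalIntegral.integral_eq_sub_of_hasDerivAt
        (f := fun t : ℝ => t ^ (a + 1) * (1 - t) ^ (b + 1))]
      · simp
      · intro t _
        have h1 : HasDerivAt (fun t : ℝ => t ^ (a + 1) * (1 - t) ^ (b + 1))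
            (((a + 1 : ℕ) : ℝ) * t ^ a * (1 - t) ^ (b + 1) +
              t ^ (a + 1) * (((b + 1 : ℕ) : ℝ) * (1 - t) ^ b * -1)) t :=
          (hasDerivAt_pow (a + 1) t).mul (((hasDerivAt_id t).const_sub 1).pow (b + 1))
        refine h1.congr_deriv ?_
        push_cast
        ring
      · exact (by fun_prop : Continuous _).intervalIntegrable _ _
    rw [intervalIntegral.integral_sub
      ((by fun_prop : Continuous _).intervalIntegrable _ _)
      ((by fun_prop : Continuous _).intervalIntegrable _ _),
      intervalIntegral.integral_const_mul, intervalIntegral.integral_const_mul, ih,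
      sub_eq_zero] at h
    have ha : (a + 1 : ℝ) ≠ 0 := by positivity
    rw [← mul_right_inj' ha, h, show a + 1 + b + 1 = a + (b + 1) + 1 by ring,
      Nat.factorial_succ a, Nat.factorial_succ b]
    push_cast
    ring

lemma cons_mem_unitSimplex {n : ℕ} {t : ℝ} {s : Fin n → ℝ} (ht : t ∈ Set.Ioo (0 : ℝ) 1) :
    Fin.cons t s ∈ unitSimplex (n + 1) ↔ s ∈ (1 - t) • unitSimplex n := by
  have h1 : 0 < 1 - t := by linarith [ht.2]
  rw [Set.mem_smul_set_iff_inv_smul_mem₀ h1.ne']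
  simp only [unitSimplex, Set.mem_ofPred_eq, Fin.forall_fin_succ, Fin.cons_zero, Fin.cons_succ,
    Fin.sum_univ_succ, Pi.smul_apply, smul_eq_mul, ← Finset.mul_sum]
  have h2 : ∀ x : ℝ, 0 ≤ (1 - t)⁻¹ * x ↔ 0 ≤ x := fun x => by
    rw [mul_nonneg_iff_of_pos_left (inv_pos.2 h1)]
  have h3 : (1 - t)⁻¹ * ∑ i, s i ≤ 1 ↔ t + ∑ i, s i ≤ 1 := by
    rw [inv_mul_le_iff₀ h1]
    constructor <;> intro h <;> linarith
  simp only [h2, h3, ht.1.le, true_and]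

/-- Integration over the unit simplex by slices. -/
lemma integral_unitSimplex_succ {n : ℕ} {f : (Fin (n + 1) → ℝ) → ℝ} (hf : Continuous f) :
    ∫ s in unitSimplex (n + 1), f s =
      ∫ t in Set.Ioo (0 : ℝ) 1, (1 - t) ^ n *
        ∫ s in unitSimplex n, f (Fin.cons t ((1 - t) • s)) := by
  have hem := (volume_preserving_piFinSuccAbove (fun _ : Fin (n + 1) => ℝ) 0).symm
  have hcons : ∀ x : ℝ × (Fin n → ℝ),
      (MeasurableEquiv.piFinSuccAbove (fun _ : Fin (n + 1) => ℝ) 0).symm x =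
        Fin.cons x.1 x.2 := fun x => by
    rw [MeasurableEquiv.symm_apply_eq]
    ext <;> simp [MeasurableEquiv.piFinSuccAbove, Fin.insertNthEquiv]
  have hint := (integrableOn_unitSimplex hf).integrable_indicator (measurableSet_unitSimplex _)
  have hint' := (hem.integrable_comp_emb
    (MeasurableEquiv.measurableEmbedding _)).2 hint
  have hprod := integral_prod _ hint'
  simp only [Function.comp_apply] at hprod
  rw [← integral_indicator (measurableSet_unitSimplex _),
    ← hem.integral_comp (MeasurableEquiv.measurableEmbedding _), Measure.volume_eq_prod,
    hprod, ← integral_indicator measurableSet_Ioo]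
  -- The two endpoints form a null set; for every other $t$ outside the open interval the slice is
  -- empty.
  have hne : ∀ᵐ t : ℝ, t ≠ 0 ∧ t ≠ 1 := by
    filter_upwards [(Set.countable_singleton (0 : ℝ)).ae_notMem volume,
      (Set.countable_singleton (1 : ℝ)).ae_notMem volume] with t h0 h1
    exact ⟨h0, h1⟩
  refine integral_congr_ae ?_
  filter_upwards [hne] with t htn
  by_cases ht : t ∈ Set.Ioo (0 : ℝ) 1
  · have h1 : 0 < 1 - t := by linarith [ht.2]
    rw [Set.indicator_of_mem ht]
    have h2 : ∀ s : Fin n → ℝ, (unitSimplex (n + 1)).indicator f (Fin.cons t s) =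
        ((1 - t) • unitSimplex n).indicator (fun s => f (Fin.cons t s)) s := by
      intro s
      by_cases hs : Fin.cons t s ∈ unitSimplex (n + 1)
      · rw [Set.indicator_of_mem hs, Set.indicator_of_mem ((cons_mem_unitSimplex ht).1 hs)]
      · rw [Set.indicator_of_notMem hs,
          Set.indicator_of_notMem (fun h => hs ((cons_mem_unitSimplex ht).2 h))]
    simp only [hcons, h2]
    rw [integral_indicator ((measurableSet_unitSimplex n).const_smul₀ _),
      Measure.setIntegral_comp_smul_of_pos volume (fun s => f (Fin.cons t s)) _ h1]
    simp only [Module.finrank_fintype_fun_eq_card, Fintype.card_fin, smul_eq_mul]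
    rw [← mul_assoc, mul_inv_cancel₀ (pow_ne_zero _ h1.ne'), one_mul]
  · rw [Set.indicator_of_notMem ht]
    simp only [hcons]
    refine integral_eq_zero_of_ae (Filter.Eventually.of_forall fun s => ?_)
    refine Set.indicator_of_notMem (fun hs => ht ?_) _
    have h0 : 0 ≤ t := by simpa using hs.1 0
    have hle : t ≤ 1 := by
      have h2 := hs.2
      simp only [Fin.sum_univ_succ, Fin.cons_zero, Fin.cons_succ] at h2
      have : 0 ≤ ∑ i, s i := Finset.sum_nonneg fun i _ => by simpa using hs.1 i.succ
      linarith
    exact ⟨h0.lt_of_ne' htn.1, hle.lt_of_ne htn.2⟩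

/-- Dirichlet's formula for the integral of a monomial over the unit simplex. -/
lemma integral_prod_pow_unitSimplex (n : ℕ) : ∀ α : Fin n → ℕ,
    ∫ s in unitSimplex n, ∏ i, s i ^ α i =
      (∏ i, ((α i).factorial : ℝ)) / ((∑ i, α i + n).factorial : ℝ) := by
  induction n with
  | zero =>
    intro α
    have : unitSimplex 0 = Set.univ := by ext s; simp [unitSimplex]
    simp [this, Measure.real, Measure.volume_pi_eq_dirac (0 : Fin 0 → ℝ)]
  | succ n ih =>
    intro α
    rw [integral_unitSimplex_succ (by fun_prop)]
    have h := integral_pow_mul_one_sub_pow (∑ i : Fin n, α i.succ + n) (α 0)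
    rw [intervalIntegral.integral_of_le zero_le_one, integral_Ioc_eq_integral_Ioo] at h
    set c : ℝ := (∏ i : Fin n, ((α i.succ).factorial : ℝ)) /
      ((∑ i : Fin n, α i.succ + n).factorial : ℝ) with hc
    have h' : ∀ t : ℝ, (1 - t) ^ n * (∫ s in unitSimplex n, ∏ i : Fin (n + 1),
        (Fin.cons t ((1 - t) • s) : Fin (n + 1) → ℝ) i ^ α i) =
        (t ^ α 0 * (1 - t) ^ (∑ i : Fin n, α i.succ + n)) * c := fun t => by
      simp only [Fin.prod_univ_succ, Fin.cons_zero, Fin.cons_succ, Pi.smul_apply, smul_eq_mul,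
        mul_pow, Finset.prod_mul_distrib, integral_const_mul, ih, Finset.prod_pow_eq_pow_sum, hc]
      ring
    simp only [h', integral_mul_const, h]
    simp only [Fin.sum_univ_succ, Fin.prod_univ_succ, hc]
    rw [show α 0 + ∑ i : Fin n, α i.succ + (n + 1) =
      α 0 + (∑ i : Fin n, α i.succ + n) + 1 by ring]
    field_simp

lemma polyIntegral_monomial {d : ℕ} (α : Fin d →₀ ℕ) :
    polyIntegral d (monomial α 1) =
      (∏ i, ((α i).factorial : ℝ)) / ((∑ i, α i + d).factorial : ℝ) := by
  rw [← integral_prod_pow_unitSimplex, polyIntegral_apply]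
  simp [eval_monomial, Finsupp.prod_fintype]

/-! ### Polynomials of bounded degree -/

variable {d : ℕ}

lemma mem_polySpace {m : ℤ} {p : MvPolynomial (Fin d) ℝ} :
    p ∈ polySpace d m ↔ ∀ α, coeff α p ≠ 0 → (α.degree : ℤ) ≤ m := by
  simp only [polySpace, mem_restrictSupport_iff, Set.subset_def, SetLike.mem_coe, mem_support_iff,
    Set.mem_ofPred_eq]

lemma mem_homogSpace {m : ℤ} {p : MvPolynomial (Fin d) ℝ} :
    p ∈ homogSpace d m ↔ ∀ α, coeff α p ≠ 0 → (α.degree : ℤ) = m := by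
  simp only [homogSpace, mem_restrictSupport_iff, Set.subset_def, SetLike.mem_coe, mem_support_iff,
    Set.mem_ofPred_eq]

lemma polySpace_mono {m n : ℤ} (h : m ≤ n) : polySpace d m ≤ polySpace d n := fun _ hp =>
  mem_polySpace.2 fun α hα => (mem_polySpace.1 hp α hα).trans h

lemma homogSpace_le_polySpace (m : ℤ) : homogSpace d m ≤ polySpace d m := fun _ hp =>
  mem_polySpace.2 fun α hα => (mem_homogSpace.1 hp α hα).le

lemma mul_mem_polySpace {m n : ℤ} {p q : MvPolynomial (Fin d) ℝ} (hp : p ∈ polySpace d m)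
    (hq : q ∈ polySpace d n) : p * q ∈ polySpace d (m + n) := by
  refine mem_polySpace.2 fun α hα => ?_
  rw [coeff_mul] at hα
  obtain ⟨x, hx, hne⟩ := Finset.exists_ne_zero_of_sum_ne_zero hα
  rw [Finset.HasAntidiagonal.mem_antidiagonal] at hx
  have h1 := mem_polySpace.1 hp _ (left_ne_zero_of_mul hne)
  have h2 := mem_polySpace.1 hq _ (right_ne_zero_of_mul hne)
  rw [← hx, map_add]
  push_cast
  omega

lemma X_mem_polySpace (a : Fin d) : (X a : MvPolynomial (Fin d) ℝ) ∈ polySpace d 1 := by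
  classical
  refine mem_polySpace.2 fun α hα => ?_
  rw [coeff_X] at hα
  have h : Finsupp.single a 1 = α := by by_contra h; simp [h] at hα
  simp [← h]

lemma C_mem_polySpace (c : ℝ) : (C c : MvPolynomial (Fin d) ℝ) ∈ polySpace d 0 := by
  classical
  refine mem_polySpace.2 fun α hα => ?_
  rw [coeff_C] at hα
  have h : 0 = α := by by_contra h; simp [h] at hα
  simp [← h]

lemma C_mul_mem_polySpace {m : ℤ} (c : ℝ) {p : MvPolynomial (Fin d) ℝ}
    (hp : p ∈ polySpace d m) : C c * p ∈ polySpace d m := by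
  rw [← smul_eq_C_mul]
  exact Submodule.smul_mem _ c hp

lemma mul_X_mem_polySpace {m : ℤ} {p : MvPolynomial (Fin d) ℝ}
    (hp : p ∈ polySpace d (m - 1)) (a : Fin d) : p * X a ∈ polySpace d m := by
  simpa using mul_mem_polySpace hp (X_mem_polySpace a)

lemma pderiv_mem_polySpace {m : ℤ} {p : MvPolynomial (Fin d) ℝ} (hp : p ∈ polySpace d m)
    (a : Fin d) : pderiv a p ∈ polySpace d (m - 1) := by
  refine mem_polySpace.2 fun α hα => ?_
  rw [coeff_pderiv] at hα
  have h := mem_polySpace.1 hp _ (left_ne_zero_of_mul hα)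
  rw [map_add, Finsupp.degree_single] at h
  push_cast at h
  omega

lemma mem_polySpace_of_X_mul {m : ℤ} {p : MvPolynomial (Fin d) ℝ} {a : Fin d}
    (hp : X a * p ∈ polySpace d m) : p ∈ polySpace d (m - 1) := by
  refine mem_polySpace.2 fun α hα => ?_
  rw [← coeff_X_mul α a p] at hα
  have h := mem_polySpace.1 hp _ hα
  rw [map_add, Finsupp.degree_single] at h
  push_cast at h
  omega

/-- Each variable costs exactly one degree. The integer bound may become negative, and then the
cofactor is zero. -/
lemma mem_polySpace_of_prod_X_mul (S : Finset (Fin d)) : ∀ {m : ℤ} {p : MvPolynomial (Fin d) ℝ},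
    (∏ a ∈ S, X a) * p ∈ polySpace d m → p ∈ polySpace d (m - S.card) := by
  classical
  induction S using Finset.induction_on with
  | empty => intro m p h; simpa using h
  | insert a S ha ih =>
    intro m p h
    rw [Finset.prod_insert ha, mul_assoc] at h
    have := ih (mem_polySpace_of_X_mul h)
    rw [Finset.card_insert_of_notMem ha]
    push_cast
    rwa [show m - ((S.card : ℤ) + 1) = m - 1 - S.card by ring]

lemma prod_X_dvd {S : Finset (Fin d)} {p : MvPolynomial (Fin d) ℝ} (h : ∀ a ∈ S, X a ∣ p) :
    ∏ a ∈ S, X a ∣ p := by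
  refine Finset.prod_dvd_of_isRelPrime (fun a _ b _ hab => ?_) h
  refine (X_prime (R := ℝ)).irreducible.isRelPrime_iff_not_dvd.2 fun hd => hab ?_
  simpa [X_dvd_X] using hd

lemma aeval_mem_polySpace {d' : ℕ} {ℓ : Fin d → MvPolynomial (Fin d') ℝ}
    (hℓ : ∀ i, ℓ i ∈ polySpace d' 1) {m : ℤ} {p : MvPolynomial (Fin d) ℝ}
    (hp : p ∈ polySpace d m) : aeval ℓ p ∈ polySpace d' m := by
  have hpow : ∀ i (n : ℕ), ℓ i ^ n ∈ polySpace d' n := by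
    intro i n
    induction n with
    | zero => simpa using C_mem_polySpace (d := d') 1
    | succ n ih => rw [pow_succ]; exact_mod_cast mul_mem_polySpace ih (hℓ i)
  have hprod : ∀ (S : Finset (Fin d)) (α : Fin d → ℕ),
      ∏ i ∈ S, ℓ i ^ α i ∈ polySpace d' (∑ i ∈ S, (α i : ℤ)) := by
    classical
    intro S α
    induction S using Finset.induction_on with
    | empty => simpa using C_mem_polySpace (d := d') 1
    | insert a S ha ih =>
      rw [Finset.prod_insert ha, Finset.sum_insert ha]
      exact mul_mem_polySpace (hpow _ _) ih
  rw [p.as_sum, map_sum]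
  refine Submodule.sum_mem _ fun α hα => ?_
  rw [aeval_monomial]
  refine C_mul_mem_polySpace _ ?_
  rw [Finsupp.prod_fintype _ _ (by simp)]
  refine polySpace_mono ?_ (hprod Finset.univ α)
  have := mem_polySpace.1 hp α (mem_support_iff.1 hα)
  rw [Finsupp.degree_eq_sum] at this
  exact_mod_cast this

/-! ### Divisibility from vanishing on hyperplanes -/

/-- Modulo `ℓ` the substitution `φ` is the identity, so `p` is congruent to its image under `φ`. -/
lemma dvd_of_aeval_eq_zero {ℓ : MvPolynomial (Fin d) ℝ} {φ : Fin d → MvPolynomial (Fin d) ℝ}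
    (hφ : ∀ i, ℓ ∣ X i - φ i) {p : MvPolynomial (Fin d) ℝ} (hp : aeval φ p = 0) : ℓ ∣ p := by
  have h : (Ideal.Quotient.mkₐ ℝ (Ideal.span {ℓ})).comp (aeval φ) =
      Ideal.Quotient.mkₐ ℝ (Ideal.span {ℓ}) := by
    refine algHom_ext fun i => ?_
    simp only [AlgHom.comp_apply, aeval_X, Ideal.Quotient.mkₐ_eq_mk]
    rw [eq_comm, Ideal.Quotient.eq, Ideal.mem_span_singleton]
    exact hφ i
  have h2 := DFunLike.congr_fun h p
  simp only [AlgHom.comp_apply, hp, map_zero, Ideal.Quotient.mkₐ_eq_mk] at h2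
  rwa [eq_comm, Ideal.Quotient.eq_zero_iff_mem, Ideal.mem_span_singleton] at h2

lemma eval_aeval {d' : ℕ} (s : Fin d' → ℝ) (φ : Fin d → MvPolynomial (Fin d') ℝ)
    (p : MvPolynomial (Fin d) ℝ) : eval s (aeval φ p) = eval (fun i => eval s (φ i)) p := by
  have : (aeval s).comp (aeval φ) = aeval (fun i => eval s (φ i)) := by
    refine algHom_ext fun i => ?_
    simp [aeval_eq_eval]
  simpa [aeval_eq_eval] using DFunLike.congr_fun this p

lemma X_dvd_of_eval_eq_zero {c : Fin d} {p : MvPolynomial (Fin d) ℝ}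
    (hp : ∀ s, s c = 0 → eval s p = 0) : X c ∣ p := by
  refine dvd_of_aeval_eq_zero (φ := fun i => if i = c then 0 else X i) (fun i => ?_) ?_
  · split_ifs with h
    · simp [h]
    · simp
  · refine MvPolynomial.funext fun s => ?_
    rw [eval_aeval, map_zero]
    exact hp _ (by simp)

lemma one_sub_sum_X_dvd_of_eval_eq_zero {p : MvPolynomial (Fin (d + 1)) ℝ}
    (hp : ∀ s, ∑ i, s i = 1 → eval s p = 0) : 1 - ∑ i, X i ∣ p := by
  -- Solving for the first variable parametrizes the slanted hyperplane by the remaining ones.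
  refine dvd_of_aeval_eq_zero (φ := Fin.cons (1 - ∑ i : Fin d, X i.succ) fun i => X i.succ)
    (fun i => ?_) ?_
  · refine Fin.cases ?_ (fun i => ?_) i
    · rw [Fin.cons_zero, Fin.sum_univ_succ]
      exact Dvd.intro (-1) (by ring)
    · simp
  · refine MvPolynomial.funext fun s => ?_
    rw [eval_aeval, map_zero]
    exact hp _ (by simp [Fin.sum_univ_succ])

/-! ### The divergence theorem and positivity -/

/-- The boundary functional of the divergence theorem on the unit simplex: the integral over the
slanted facet, in the measure for which it takes the value `α! / (|α| + d - 1)!` on `s ^ α`. -/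
def slantIntegral (d : ℕ) : MvPolynomial (Fin d) ℝ →ₗ[ℝ] ℝ :=
  (basisMonomials (Fin d) ℝ).constr ℝ fun α =>
    (∏ i, ((α i).factorial : ℝ)) * ((∑ i, α i + d : ℕ) : ℝ) / ((∑ i, α i + d).factorial : ℝ)

lemma slantIntegral_monomial (α : Fin d →₀ ℕ) : slantIntegral d (monomial α 1) =
    (∏ i, ((α i).factorial : ℝ)) * ((∑ i, α i + d : ℕ) : ℝ) / ((∑ i, α i + d).factorial : ℝ) := by
  have := (basisMonomials (Fin d) ℝ).constr_basis ℝ (fun α : Fin d →₀ ℕ =>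
    (∏ i, ((α i).factorial : ℝ)) * ((∑ i, α i + d : ℕ) : ℝ) / ((∑ i, α i + d).factorial : ℝ)) α
  simpa [slantIntegral] using this

lemma prod_factorial_add_single (α : Fin d →₀ ℕ) (a : Fin d) :
    ∏ i, (((α + Finsupp.single a 1 : Fin d →₀ ℕ) i).factorial : ℝ) =
      (α a + 1) * ∏ i, ((α i).factorial : ℝ) := by
  classical
  rw [← Finset.mul_prod_erase _ _ (Finset.mem_univ a),
    ← Finset.mul_prod_erase _ (fun i => ((α i).factorial : ℝ)) (Finset.mem_univ a), ← mul_assoc]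
  congr 1
  · simp [Nat.factorial_succ]
  · refine Finset.prod_congr rfl fun i hi => ?_
    simp [Finsupp.single_eq_of_ne (Finset.ne_of_mem_erase hi)]

lemma sum_add_single (α : Fin d →₀ ℕ) (a : Fin d) :
    ∑ i, (α + Finsupp.single a 1 : Fin d →₀ ℕ) i = ∑ i, α i + 1 := by
  rw [← Finsupp.degree_eq_sum, map_add, Finsupp.degree_single, Finsupp.degree_eq_sum]

lemma X_mul_monomial_one (α : Fin d →₀ ℕ) (a : Fin d) :
    X a * monomial α (1 : ℝ) = monomial (α + Finsupp.single a 1) 1 := by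
  rw [X, monomial_mul, one_mul, add_comm]

/-- The fundamental theorem of calculus along the $a$-axis: the factor $x_a$ removes the coordinate
facet and only the slanted one contributes. By linearity it suffices to compare Dirichlet's formulas
on monomials. -/
lemma polyIntegral_pderiv_X_mul (a : Fin d) (w : MvPolynomial (Fin d) ℝ) :
    polyIntegral d (pderiv a (X a * w)) = slantIntegral d (X a * w) := by
  have h : (polyIntegral d) ∘ₗ (pderiv a).toLinearMap ∘ₗ (LinearMap.mulLeft ℝ (X a)) =
      (slantIntegral d) ∘ₗ (LinearMap.mulLeft ℝ (X a)) := by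
    refine (basisMonomials (Fin d) ℝ).ext fun α => ?_
    simp only [coe_basisMonomials, LinearMap.comp_apply, LinearMap.mulLeft_apply,
      Derivation.coeFn_coe, X_mul_monomial_one, pderiv_monomial, slantIntegral_monomial,
      add_tsub_cancel_right, one_mul]
    rw [← mul_one (((α + Finsupp.single a 1 : Fin d →₀ ℕ) a : ℕ) : ℝ), ← smul_eq_mul, ← smul_monomial,
      map_smul, polyIntegral_monomial, prod_factorial_add_single, sum_add_single,
      show ∑ i, α i + 1 + d = (∑ i, α i + d) + 1 by ring, Nat.factorial_succ]
    have h2 : ((∑ i, α i + d + 1 : ℕ) : ℝ) ≠ 0 := by positivity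
    have h3 : ((∑ i, α i + d).factorial : ℝ) ≠ 0 := by positivity
    rw [Nat.cast_mul]
    simp only [Finsupp.add_apply, Finsupp.single_eq_same, smul_eq_mul]
    field_simp
    push_cast
    ring
  exact DFunLike.congr_fun h w

/-- The functional is supported on the slanted facet. On monomials this is
$\sum_i(\alpha_i+1)=|\alpha|+d$. -/
lemma slantIntegral_one_sub_sum_X_mul (w : MvPolynomial (Fin d) ℝ) :
    slantIntegral d ((1 - ∑ i, X i) * w) = 0 := by
  have h : (slantIntegral d) ∘ₗ (LinearMap.mulLeft ℝ (1 - ∑ i, X i)) = 0 := by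
    refine (basisMonomials (Fin d) ℝ).ext fun α => ?_
    simp only [coe_basisMonomials, LinearMap.comp_apply, LinearMap.mulLeft_apply, sub_mul,
      Finset.sum_mul, one_mul, X_mul_monomial_one, map_sub, map_sum, LinearMap.zero_apply,
      slantIntegral_monomial, prod_factorial_add_single, sum_add_single]
    have h2 : ((∑ i, α i + d + 1 : ℕ) : ℝ) ≠ 0 := by positivity
    have h3 : ((∑ i, α i + d).factorial : ℝ) ≠ 0 := by positivity
    simp only [show ∑ i, α i + 1 + d = (∑ i, α i + d) + 1 by ring, Nat.factorial_succ,
      Nat.cast_mul, mul_comm _ ((∑ i, α i + d + 1 : ℕ) : ℝ),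
      mul_div_mul_left _ _ h2, ← Finset.sum_div, ← Finset.sum_mul, Finset.sum_add_distrib]
    simp
    ring
  exact DFunLike.congr_fun h w

/-- The divergence theorem for polynomial vector fields tangent to the boundary of the unit
simplex. -/
lemma sum_polyIntegral_pderiv_eq_zero {u : Fin d → MvPolynomial (Fin d) ℝ}
    (hu : ∀ a, X a ∣ u a) (hs : 1 - ∑ i, X i ∣ ∑ a, u a) :
    ∑ a, polyIntegral d (pderiv a (u a)) = 0 := by
  obtain ⟨r, hr⟩ := hs
  have h : ∀ a, polyIntegral d (pderiv a (u a)) = slantIntegral d (u a) := fun a => by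
    obtain ⟨w, hw⟩ := hu a
    rw [hw, polyIntegral_pderiv_X_mul]
  simp only [h]
  rw [← map_sum, hr, slantIntegral_one_sub_sum_X_mul]

lemma mem_unitSimplex_of_mem_box {s : Fin d → ℝ} (hs : s ∈ Set.pi Set.univ fun _ : Fin d =>
    Set.Ioo (0 : ℝ) (1 / (d + 1))) : s ∈ unitSimplex d := by
  have hs' : ∀ a, 0 < s a ∧ s a < 1 / (d + 1) := fun a => hs a (Set.mem_univ a)
  refine ⟨fun a => (hs' a).1.le, ?_⟩
  calc ∑ a, s a ≤ ∑ _a : Fin d, (1 / (d + 1) : ℝ) := Finset.sum_le_sum fun a _ => (hs' a).2.le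
    _ ≤ 1 := by
      simp only [Finset.sum_const, Finset.card_univ, Fintype.card_fin, nsmul_eq_mul, mul_one_div]
      rw [div_le_one (by positivity)]
      linarith

/-- The integrand vanishes almost everywhere on the simplex, hence everywhere on an open box inside
it, and a polynomial is determined by its values on such a box. The side $1/(d+1)$ also makes sense
for $d=0$. -/
lemma eq_zero_of_polyIntegral_eq_zero {p : MvPolynomial (Fin d) ℝ}
    (hp : ∀ s ∈ unitSimplex d, 0 ≤ eval s p) (h : polyIntegral d p = 0) : p = 0 := by
  set U : Set (Fin d → ℝ) := Set.pi Set.univ fun _ => Set.Ioo (0 : ℝ) (1 / (d + 1)) with hU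
  have hUo : IsOpen U := isOpen_set_pi Set.finite_univ fun _ _ => isOpen_Ioo
  have hcont := continuous_eval_mvPolynomial p
  have hae : (fun s => eval s p) =ᵐ[volume.restrict (unitSimplex d)] 0 := by
    refine (setIntegral_eq_zero_iff_of_nonneg_ae ?_ (integrableOn_unitSimplex hcont)).1 h
    exact (ae_restrict_iff' (measurableSet_unitSimplex d)).2 (Filter.Eventually.of_forall hp)
  have hae' : (fun s => eval s p) =ᵐ[volume.restrict U] 0 :=
    ae_restrict_of_ae_restrict_of_subset (fun s hs => mem_unitSimplex_of_mem_box hs) hae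
  have heq := Measure.eqOn_open_of_ae_eq hae' hUo hcont.continuousOn continuousOn_const
  refine funext_set (fun _ => Set.Ioo (0 : ℝ) (1 / (d + 1)))
    (fun _ => Set.Ioo_infinite (by positivity)) fun s hs => ?_
  rw [map_zero]
  exact heq hs

/-- Positivity of the variables on the simplex lets a polynomial divisible by variables be tested
against its own cofactor. -/
lemma eq_zero_of_polyIntegral_prod_X_mul_sq (S : Finset (Fin d)) {w : MvPolynomial (Fin d) ℝ}
    (h : polyIntegral d ((∏ a ∈ S, X a) * w * w) = 0) : w = 0 := by
  have h1 := eq_zero_of_polyIntegral_eq_zero (fun s hs => ?_) h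
  · have hne : (∏ a ∈ S, X a : MvPolynomial (Fin d) ℝ) ≠ 0 :=
      Finset.prod_ne_zero_iff.2 fun a _ => X_ne_zero a
    simpa [hne] using h1
  · rw [mul_assoc, map_mul, map_mul, map_prod]
    refine mul_nonneg (Finset.prod_nonneg fun a _ => ?_) (mul_self_nonneg _)
    simpa using hs.1 a

/-! ### Trimmed 2-forms with vanishing trace -/

lemma coeff_X_mul_pderiv (α : Fin d →₀ ℕ) (a : Fin d) (p : MvPolynomial (Fin d) ℝ) :
    coeff α (X a * pderiv a p) = α a * coeff α p := by
  classical
  induction p using MvPolynomial.induction_on' with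
  | monomial β r =>
    rw [X_mul_pderiv_monomial, coeff_smul, coeff_monomial]
    split_ifs with h
    · simp [h]
    · simp
  | add p q hp hq => rw [map_add, mul_add, coeff_add, hp, hq, coeff_add, mul_add]

/-- The Lie derivative of a 2-form along $x$ multiplies coefficients of degree $m$ by $m+2$, which
is never zero, so it cannot hide a high-degree term. -/
lemma mem_polySpace_of_euler {m : ℤ} {p : MvPolynomial (Fin d) ℝ}
    (h : ∑ e, X e * pderiv e p + 2 * p ∈ polySpace d m) : p ∈ polySpace d m := by
  refine mem_polySpace.2 fun α hα => mem_polySpace.1 h α ?_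
  have h2 : (2 : MvPolynomial (Fin d) ℝ) = C 2 := (map_ofNat C 2).symm
  rw [coeff_add, coeff_sum, h2, coeff_C_mul]
  simp only [coeff_X_mul_pderiv]
  rw [← Finset.sum_mul, ← add_mul]
  exact mul_ne_zero (by positivity) hα

lemma sum_map_pi_single {M N : Type*} [AddCommMonoid M] [AddCommMonoid N] (f : Fin d → M →+ N)
    (a : Fin d) (p : M) : ∑ e, f e ((Pi.single a p : Fin d → M) e) = f a p := by
  rw [Finset.sum_eq_single a (fun b _ hb => by rw [Pi.single_eq_of_ne hb, map_zero])
    (by simp), Pi.single_eq_same]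

/-- The components of the exterior derivative of the 2-form with coefficients `G`. -/
def extDeriv (G : Matrix (Fin d) (Fin d) (MvPolynomial (Fin d) ℝ)) (a b c : Fin d) :
    MvPolynomial (Fin d) ℝ :=
  pderiv a (G b c) + pderiv b (G c a) + pderiv c (G a b)

/-- The coefficients of a polynomial 2-form of degree at most `k` on the unit simplex, whose
contraction with the position vector has degree at most `k` as well. -/
structure IsTrimmed (k : ℤ) (G : Matrix (Fin d) (Fin d) (MvPolynomial (Fin d) ℝ)) : Prop where
  skew : ∀ a b, G a b = -G b a
  degree : ∀ a b, G a b ∈ polySpace d k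
  contraction : ∀ a, ∑ b, G a b * X b ∈ polySpace d k

/-- The trace of a 2-form on every facet of the unit simplex vanishes. -/
structure HasZeroTrace (G : Matrix (Fin d) (Fin d) (MvPolynomial (Fin d) ℝ)) : Prop where
  coord : ∀ a b c, a ≠ b → c ≠ a → c ≠ b → X c ∣ G a b
  slant : ∀ a b c, 1 - ∑ i, X i ∣ G a b + G b c + G c a

variable {k : ℤ} {G : Matrix (Fin d) (Fin d) (MvPolynomial (Fin d) ℝ)}

lemma IsTrimmed.diag (hG : IsTrimmed k G) (a : Fin d) : G a a = 0 :=
  self_eq_neg.1 (hG.skew a a)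

/-- Stokes for $qG$: zero trace removes the boundary terms. What remains pairs $G$ with first
derivatives of $q$, of degree at most $k+1-d$, so the moment hypothesis applies. -/
lemma HasZeroTrace.polyIntegral_extDeriv_mul (hG : HasZeroTrace G)
    (hmom : ∀ a b, ∀ q ∈ polySpace d (k + 1 - d), polyIntegral d (G a b * q) = 0)
    {a b c : Fin d} (hab : a ≠ b) (hbc : b ≠ c) (hca : c ≠ a)
    {q : MvPolynomial (Fin d) ℝ} (hq : q ∈ polySpace d (k + 2 - d)) :
    polyIntegral d (extDeriv G a b c * q) = 0 := by
  classical
  -- The divergence of this field is the exterior derivative of $qG$ in the directions $a,b,c$. The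
  -- conditions `coord` and `slant` say that it is tangent to the boundary of the simplex.
  set u : Fin d → MvPolynomial (Fin d) ℝ :=
    Pi.single a (G b c * q) + Pi.single b (G c a * q) + Pi.single c (G a b * q) with hu
  have hX : ∀ e, X e ∣ u e := by
    intro e
    simp only [hu, Pi.add_apply, Pi.single_apply]
    refine dvd_add (dvd_add ?_ ?_) ?_
    · split_ifs with h
      · exact (h ▸ hG.coord b c a hbc hab hca.symm).mul_right q
      · exact dvd_zero _
    · split_ifs with h
      · exact (h ▸ hG.coord c a b hca hbc hab.symm).mul_right q
      · exact dvd_zero _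
    · split_ifs with h
      · exact (h ▸ hG.coord a b c hab hca hbc.symm).mul_right q
      · exact dvd_zero _
  have hs : 1 - ∑ i, X i ∣ ∑ e, u e := by
    have hsum : ∑ e, u e = (G a b + G b c + G c a) * q := by
      have h1 : ∀ (a : Fin d) (p : MvPolynomial (Fin d) ℝ),
          ∑ e, (Pi.single a p : Fin d → MvPolynomial (Fin d) ℝ) e = p :=
        fun a p => sum_map_pi_single (fun _ => AddMonoidHom.id _) a p
      simp only [hu, Pi.add_apply, Finset.sum_add_distrib, h1]
      ring
    rw [hsum]
    exact (hG.slant a b c).mul_right q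
  have h := sum_polyIntegral_pderiv_eq_zero hX hs
  have hsingle : ∀ (a : Fin d) (p : MvPolynomial (Fin d) ℝ),
      ∑ e, polyIntegral d (pderiv e ((Pi.single a p : Fin d → MvPolynomial (Fin d) ℝ) e)) =
        polyIntegral d (pderiv a p) := fun a p =>
    sum_map_pi_single (fun e => ((polyIntegral d) ∘ₗ (pderiv e).toLinearMap).toAddMonoidHom) a p
  simp only [hu, Pi.add_apply, map_add, Finset.sum_add_distrib, hsingle, Derivation.leibniz,
    smul_eq_mul] at h
  have hq' : ∀ e, pderiv e q ∈ polySpace d (k + 1 - d) := fun e => by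
    have := pderiv_mem_polySpace hq e
    rwa [show k + 2 - d - 1 = k + 1 - (d : ℤ) by ring] at this
  rw [hmom b c _ (hq' a), hmom c a _ (hq' b), hmom a b _ (hq' c)] at h
  rw [extDeriv, mul_comm, mul_add, mul_add, map_add, map_add]
  linarith

lemma IsTrimmed.extDeriv_eq_zero (hG : IsTrimmed k G) (hG' : HasZeroTrace G)
    (hmom : ∀ a b, ∀ q ∈ polySpace d (k + 1 - d), polyIntegral d (G a b * q) = 0)
    {a b c : Fin d} (hab : a ≠ b) (hbc : b ≠ c) (hca : c ≠ a) : extDeriv G a b c = 0 := by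
  classical
  set S : Finset (Fin d) := Finset.univ \ {a, b, c} with hS
  have hcard : (S.card : ℤ) = d - 3 := by
    have h3 : ({a, b, c} : Finset (Fin d)).card = 3 := Finset.card_eq_three.2
      ⟨a, b, c, hab, hca.symm, hbc, rfl⟩
    have := Finset.card_sdiff_add_card_eq_card (Finset.subset_univ {a, b, c})
    rw [h3, Finset.card_univ, Fintype.card_fin] at this
    rw [hS]
    omega
  have hpd : ∀ {e x y z : Fin d}, x ≠ y → e ≠ x → e ≠ y → e ≠ z →
      X e ∣ pderiv z (G x y) := by
    intro e x y z hxy hx hy hz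
    obtain ⟨w, hw⟩ := hG'.coord x y e hxy hx hy
    rw [hw, Derivation.leibniz, pderiv_X_of_ne hz, smul_zero, add_zero, smul_eq_mul]
    exact Dvd.intro _ rfl
  have hdvd : ∏ e ∈ S, X e ∣ extDeriv G a b c := by
    refine prod_X_dvd fun e he => ?_
    simp only [hS, Finset.mem_sdiff, Finset.mem_univ, true_and, Finset.mem_insert,
      Finset.mem_singleton, not_or] at he
    obtain ⟨ha, hb, hc⟩ := he
    exact dvd_add (dvd_add (hpd hbc hb hc ha) (hpd hca hc ha hb)) (hpd hab ha hb hc)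
  obtain ⟨w, hw⟩ := hdvd
  have hdeg : extDeriv G a b c ∈ polySpace d (k - 1) :=
    Submodule.add_mem _ (Submodule.add_mem _ (pderiv_mem_polySpace (hG.degree _ _) _)
      (pderiv_mem_polySpace (hG.degree _ _) _)) (pderiv_mem_polySpace (hG.degree _ _) _)
  rw [hw] at hdeg
  have hwdeg := mem_polySpace_of_prod_X_mul S hdeg
  -- The cofactor has exactly the degree allowed for a Stokes test function, so it can be tested
  -- against itself.
  rw [hcard, show k - 1 - ((d : ℤ) - 3) = k + 2 - d by ring] at hwdeg
  have h := hG'.polyIntegral_extDeriv_mul hmom hab hbc hca hwdeg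
  rw [hw] at h
  rw [hw, eq_zero_of_polyIntegral_prod_X_mul_sq S h, mul_zero]

/-- A closed trimmed 2-form of degree `k` has degree `k - 1`. -/
lemma IsTrimmed.mem_polySpace_of_closed (hG : IsTrimmed k G)
    (hclosed : ∀ a b c, extDeriv G a b c = 0) (a b : Fin d) : G a b ∈ polySpace d (k - 1) := by
  classical
  refine mem_polySpace_of_euler ?_
  have h : ∀ a b, pderiv b (∑ e, G a e * X e) = ∑ e, X e * pderiv b (G a e) + G a b := by
    intro a b
    simp only [map_sum, Derivation.leibniz, smul_eq_mul, Finset.sum_add_distrib, pderiv_X]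
    rw [add_comm]
    simp [Pi.single_apply]
  -- Cartan's formula $L_xG=d(i_xG)+i_x\,dG$ with $dG=0$. The right side differentiates a
  -- contraction of degree at most $k$.
  have h2 : ∑ e, X e * pderiv e (G a b) + 2 * G a b =
      pderiv b (∑ e, G a e * X e) - pderiv a (∑ e, G b e * X e) := by
    rw [h, h, hG.skew b a]
    have h3 : ∀ e, pderiv e (G a b) = pderiv b (G a e) - pderiv a (G b e) := fun e => by
      have h4 := hclosed a b e
      rw [extDeriv, hG.skew e a, map_neg] at h4
      linear_combination h4
    simp only [h3, mul_sub, Finset.sum_sub_distrib]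
    ring
  rw [h2]
  exact Submodule.sub_mem _ (pderiv_mem_polySpace (hG.contraction a) b)
    (pderiv_mem_polySpace (hG.contraction b) a)

/-- A trimmed 2-form with vanishing trace and vanishing interior moments is zero. -/
theorem IsTrimmed.eq_zero (hG : IsTrimmed k G) (hG' : HasZeroTrace G)
    (hmom : ∀ a b, ∀ q ∈ polySpace d (k + 1 - d), polyIntegral d (G a b * q) = 0) : G = 0 := by
  classical
  have hclosed : ∀ a b c, extDeriv G a b c = 0 := by
    intro a b c
    by_cases hab : a = b
    · rw [hab, extDeriv, hG.diag, hG.skew c b]; simp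
    by_cases hbc : b = c
    · rw [hbc, extDeriv, hG.diag, hG.skew c a]; simp
    by_cases hca : c = a
    · rw [hca, extDeriv, hG.diag, hG.skew b a]; simp
    exact hG.extDeriv_eq_zero hG' hmom hab hbc hca
  ext1 a b
  rw [Matrix.zero_apply]
  by_cases hab : a = b
  · rw [hab, hG.diag]
  set S : Finset (Fin d) := Finset.univ \ {a, b} with hS
  have hcard : (S.card : ℤ) = d - 2 := by
    have := Finset.card_sdiff_add_card_eq_card (Finset.subset_univ {a, b})
    rw [Finset.card_pair hab, Finset.card_univ, Fintype.card_fin] at this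
    rw [hS]
    omega
  obtain ⟨w, hw⟩ : ∏ e ∈ S, X e ∣ G a b := by
    refine prod_X_dvd fun e he => ?_
    simp only [hS, Finset.mem_sdiff, Finset.mem_univ, true_and, Finset.mem_insert,
      Finset.mem_singleton, not_or] at he
    exact hG'.coord a b e hab he.1 he.2
  have hdeg := hG.mem_polySpace_of_closed hclosed a b
  rw [hw] at hdeg
  have hwdeg := mem_polySpace_of_prod_X_mul S hdeg
  -- The degree gained from closedness is what makes the cofactor an admissible moment; from degree
  -- $k$ it would be one too high.
  rw [hcard, show k - 1 - ((d : ℤ) - 2) = k + 1 - d by ring] at hwdeg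
  have h := hmom a b w hwdeg
  rw [hw] at h
  rw [hw, eq_zero_of_polyIntegral_prod_X_mul_sq S h, mul_zero]

/-! ### The space of trimmed 2-forms on `ℝ⁴` -/

/-- The trimmed 2-forms of degree `k`, as a submodule. -/
def trimmedSpace (d : ℕ) (k : ℤ) : Submodule ℝ (Matrix (Fin d) (Fin d) (MvPolynomial (Fin d) ℝ)) where
  carrier := {G | IsTrimmed k G}
  zero_mem' := ⟨by simp, by simp, by simp⟩
  add_mem' {G H} hG hH := ⟨fun a b => by simp [hG.skew a b, hH.skew a b]; ring,
    fun a b => Submodule.add_mem _ (hG.degree a b) (hH.degree a b),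
    fun a => by
      simp only [Matrix.add_apply, add_mul, Finset.sum_add_distrib]
      exact Submodule.add_mem _ (hG.contraction a) (hH.contraction a)⟩
  smul_mem' c G hG := ⟨fun a b => by simp [hG.skew a b],
    fun a b => Submodule.smul_mem _ c (hG.degree a b),
    fun a => by
      simp only [Matrix.smul_apply, smul_mul_assoc, ← Finset.smul_sum]
      exact Submodule.smul_mem _ c (hG.contraction a)⟩

lemma skew_mem_trimmedSpace {k : ℤ} {w : Fin 6 → MvPolynomial (Fin 4) ℝ}
    (hw : ∀ a, w a ∈ polySpace 4 (k - 1)) : skew w ∈ trimmedSpace 4 k := by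
  have hdeg : ∀ i j, skew w i j ∈ polySpace 4 (k - 1) := by
    intro i j
    fin_cases i <;> fin_cases j <;> simp [skew, hw]
  refine ⟨fun i j => ?_, fun i j => polySpace_mono (by omega) (hdeg i j),
    fun i => Submodule.sum_mem _ fun j _ => mul_X_mem_polySpace (hdeg i j) j⟩
  fin_cases i <;> fin_cases j <;> simp [skew]

lemma B_skew (c i j : Fin 4) : B c i j = -B c j i := by
  fin_cases c <;> fin_cases i <;> fin_cases j <;> simp [B]

lemma B_mem_polySpace (c i j : Fin 4) : B c i j ∈ polySpace 4 1 := by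
  fin_cases c <;> fin_cases i <;> fin_cases j <;> simp [B, X_mem_polySpace]

/-- Up to sign, $B_c$ is the contraction of $x$ with a constant 3-form, and contracting twice with
$x$ gives zero. -/
lemma B_contraction (c i : Fin 4) : ∑ j, B c i j * X j = 0 := by
  fin_cases c <;> fin_cases i <;> simp [B, Fin.sum_univ_four] <;> ring

lemma mulField_apply (A : MatrixField) (p : MvPolynomial (Fin 4) ℝ) (i j : Fin 4) :
    mulField A p i j = p * A i j := rfl

lemma mulField_B_mem_trimmedSpace {k : ℤ} {p : MvPolynomial (Fin 4) ℝ}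
    (hp : p ∈ polySpace 4 (k - 1)) (c : Fin 4) : mulField (B c) p ∈ trimmedSpace 4 k := by
  refine ⟨fun i j => ?_, fun i j => ?_, fun i => ?_⟩
  · rw [mulField_apply, mulField_apply, B_skew, mul_neg]
  · rw [mulField_apply]
    simpa using mul_mem_polySpace hp (B_mem_polySpace c i j)
  · simp only [mulField_apply, mul_assoc, ← Finset.mul_sum, B_contraction, mul_zero]
    exact Submodule.zero_mem _

lemma twoFormSpace_le_trimmedSpace (k : ℕ) : twoFormSpace k ≤ trimmedSpace 4 k := by
  refine sup_le ?_ (iSup_le fun c => ?_)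
  · rintro _ ⟨w, hw, rfl⟩
    exact skew_mem_trimmedSpace fun a => hw a (Set.mem_univ a)
  · rintro _ ⟨p, hp, rfl⟩
    exact mulField_B_mem_trimmedSpace (homogSpace_le_polySpace _ hp) c

/-! ### Pullback to a simplex -/

/-- The coordinate functions of `param p`. -/
def paramPoly (p : Fin (d + 1) → Fin 4 → ℝ) (i : Fin 4) : MvPolynomial (Fin d) ℝ :=
  C (p 0 i) + ∑ a, C (edge p a i) * X a

lemma eval_paramPoly (p : Fin (d + 1) → Fin 4 → ℝ) (s : Fin d → ℝ) (i : Fin 4) :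
    eval s (paramPoly p i) = param p s i := by
  simp [paramPoly, param, mul_comm]

lemma paramPoly_mem_polySpace (p : Fin (d + 1) → Fin 4 → ℝ) (i : Fin 4) :
    paramPoly p i ∈ polySpace d 1 :=
  Submodule.add_mem _ (polySpace_mono zero_le_one (C_mem_polySpace _))
    (Submodule.sum_mem _ fun a _ => C_mul_mem_polySpace _ (X_mem_polySpace a))

lemma eval_aeval_paramPoly (p : Fin (d + 1) → Fin 4 → ℝ) (s : Fin d → ℝ)
    (q : MvPolynomial (Fin 4) ℝ) : eval s (aeval (paramPoly p) q) = eval (param p s) q := by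
  rw [eval_aeval]
  simp only [eval_paramPoly]

/-- The coefficients of the pullback of a 2-form to the simplex with vertices `p`, in the affine
coordinates of the simplex. -/
def pull (p : Fin (d + 1) → Fin 4 → ℝ) :
    MatrixField →ₗ[ℝ] Matrix (Fin d) (Fin d) (MvPolynomial (Fin d) ℝ) where
  toFun F := Matrix.of fun a b =>
    ∑ i, ∑ j, C (edge p a i * edge p b j) * aeval (paramPoly p) (F i j)
  map_add' F G := by
    ext1 a b
    simp [mul_add, Finset.sum_add_distrib]
  map_smul' c F := by
    ext1 a b
    simp [Finset.smul_sum]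

lemma pull_apply (p : Fin (d + 1) → Fin 4 → ℝ) (F : MatrixField) (a b : Fin d) :
    pull p F a b = ∑ i, ∑ j, C (edge p a i * edge p b j) * aeval (paramPoly p) (F i j) := rfl

lemma eval_pull (p : Fin (d + 1) → Fin 4 → ℝ) (F : MatrixField) (s : Fin d → ℝ) (a b : Fin d) :
    eval s (pull p F a b) = edge p a ⬝ᵥ evalField F (param p s) *ᵥ edge p b := by
  simp only [pull_apply, map_sum, map_mul, eval_C, eval_aeval_paramPoly, dotProduct, mulVec,
    Finset.mul_sum, evalField, Matrix.map_apply]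
  refine Finset.sum_congr rfl fun i _ => Finset.sum_congr rfl fun j _ => ?_
  ring

/-- The degree of the contraction does not depend on the origin: moving it to the base vertex $p_0$
changes $i_xF$ by the contraction with a constant vector, of degree at most $k$. -/
lemma IsTrimmed.pull {k : ℤ} {F : MatrixField} (hF : IsTrimmed k F)
    (p : Fin (d + 1) → Fin 4 → ℝ) : IsTrimmed k (pull p F) := by
  refine ⟨fun a b => ?_, fun a b => ?_, fun a => ?_⟩
  · rw [pull_apply, pull_apply, Finset.sum_comm, ← Finset.sum_neg_distrib]
    refine Finset.sum_congr rfl fun i _ => ?_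
    rw [← Finset.sum_neg_distrib]
    refine Finset.sum_congr rfl fun j _ => ?_
    rw [hF.skew, map_neg, mul_comm (edge p a j)]
    ring
  · rw [pull_apply]
    exact Submodule.sum_mem _ fun i _ => Submodule.sum_mem _ fun j _ =>
      C_mul_mem_polySpace _ (aeval_mem_polySpace (paramPoly_mem_polySpace p) (hF.degree i j))
  · have h : ∑ b, Pentatope.pull p F a b * X b =
        ∑ i, C (edge p a i) * (aeval (paramPoly p) (∑ j, F i j * X j) -
          ∑ j, C (p 0 j) * aeval (paramPoly p) (F i j)) := by
      have h1 : ∀ j : Fin 4, ∑ b, C (edge p b j) * X b = paramPoly p j - C (p 0 j) := fun j => by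
        rw [paramPoly]; ring
      calc ∑ b, Pentatope.pull p F a b * X b
          = ∑ b, ∑ i, ∑ j, C (edge p a i) * aeval (paramPoly p) (F i j) *
              (C (edge p b j) * X b) := by
            simp only [pull_apply, Finset.sum_mul, C_mul]
            refine Finset.sum_congr rfl fun b _ => Finset.sum_congr rfl fun i _ =>
              Finset.sum_congr rfl fun j _ => ?_
            ring
        _ = ∑ i, ∑ j, C (edge p a i) * aeval (paramPoly p) (F i j) *
              (paramPoly p j - C (p 0 j)) := by
            rw [Finset.sum_comm]
            refine Finset.sum_congr rfl fun i _ => ?_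
            rw [Finset.sum_comm]
            refine Finset.sum_congr rfl fun j _ => ?_
            rw [← Finset.mul_sum, h1]
        _ = _ := by
            refine Finset.sum_congr rfl fun i _ => ?_
            rw [map_sum, ← Finset.sum_sub_distrib, Finset.mul_sum]
            refine Finset.sum_congr rfl fun j _ => ?_
            rw [map_mul, aeval_X]
            ring
    rw [h]
    refine Submodule.sum_mem _ fun i _ => C_mul_mem_polySpace _ (Submodule.sub_mem _ ?_ ?_)
    · exact aeval_mem_polySpace (paramPoly_mem_polySpace p) (hF.contraction i)
    · exact Submodule.sum_mem _ fun j _ => C_mul_mem_polySpace _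
        (aeval_mem_polySpace (paramPoly_mem_polySpace p) (hF.degree i j))

lemma edge_comp_succAbove_succ (p : Fin (d + 2) → Fin 4 → ℝ) (c : Fin (d + 1)) (a : Fin d) :
    edge (p ∘ c.succ.succAbove) a = edge p (c.succAbove a) := by
  simp [edge, Fin.succ_succAbove_succ]

lemma edge_comp_succAbove_zero (p : Fin (d + 2) → Fin 4 → ℝ) (a : Fin d) :
    edge (p ∘ (0 : Fin (d + 2)).succAbove) a = edge p a.succ - edge p 0 := by
  simp [edge]

lemma param_comp_succAbove_succ (p : Fin (d + 2) → Fin 4 → ℝ) {c : Fin (d + 1)}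
    {s : Fin (d + 1) → ℝ} (hs : s c = 0) :
    param (p ∘ c.succ.succAbove) (s ∘ c.succAbove) = param p s := by
  rw [param, param, Fin.sum_univ_succAbove _ c, hs]
  simp [edge_comp_succAbove_succ]

lemma param_comp_succAbove_zero (p : Fin (d + 2) → Fin 4 → ℝ)
    {s : Fin (d + 1) → ℝ} (hs : ∑ a, s a = 1) :
    param (p ∘ (0 : Fin (d + 2)).succAbove) (s ∘ Fin.succ) = param p s := by
  rw [Fin.sum_univ_succ] at hs
  have h0 : s 0 = 1 - ∑ a : Fin d, s a.succ := by linarith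
  rw [param, param, Fin.sum_univ_succ, h0]
  simp only [edge_comp_succAbove_zero, Function.comp_apply, smul_sub, Finset.sum_sub_distrib,
    ← Finset.sum_smul, sub_smul, one_smul]
  have : edge p 0 = p 1 - p 0 := rfl
  simp only [Fin.zero_succAbove, Fin.succ_zero_eq_one, this]
  abel

/-- If the pullbacks of a 2-form to the facets of a simplex vanish, then its pullback to the
simplex has vanishing trace. -/
lemma hasZeroTrace_pull {F : MatrixField} (hF : ∀ i j, F i j = -F j i)
    (p : Fin (d + 2) → Fin 4 → ℝ) (h : ∀ i : Fin (d + 2), pull (p ∘ i.succAbove) F = 0) :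
    HasZeroTrace (pull p F) := by
  have hskew : ∀ (x u w : Fin 4 → ℝ),
      u ⬝ᵥ evalField F x *ᵥ w = -(w ⬝ᵥ evalField F x *ᵥ u) := by
    intro x u w
    have : (evalField F x)ᵀ = -evalField F x := by
      ext i j
      simp [evalField, hF j i]
    rw [dotProduct_mulVec, dotProduct_comm, ← mulVec_transpose, this, neg_mulVec, dotProduct_neg]
  have heval : ∀ (i : Fin (d + 2)) (s : Fin d → ℝ) (a b : Fin d),
      edge (p ∘ i.succAbove) a ⬝ᵥ evalField F (param (p ∘ i.succAbove) s) *ᵥ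
        edge (p ∘ i.succAbove) b = 0 := by
    intro i s a b
    rw [← eval_pull, h i]
    simp
  refine ⟨fun a b c _ hca hcb => X_dvd_of_eval_eq_zero fun s hs => ?_, fun a b c =>
    one_sub_sum_X_dvd_of_eval_eq_zero fun s hs => ?_⟩
  · obtain ⟨a', rfl⟩ := Fin.exists_succAbove_eq hca.symm
    obtain ⟨b', rfl⟩ := Fin.exists_succAbove_eq hcb.symm
    rw [eval_pull, ← param_comp_succAbove_succ p hs, ← edge_comp_succAbove_succ,
      ← edge_comp_succAbove_succ]
    exact heval _ _ _ _
  -- On the slanted facet the differences of edges are tangent, so $G_{ab}=G_{a0}+G_{0b}$ there; the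
  -- cyclic sum cancels by skewness.
  · have key : ∀ a b, (edge p a - edge p 0) ⬝ᵥ evalField F (param p s) *ᵥ
        (edge p b - edge p 0) = 0 := by
      intro a b
      refine Fin.cases (by simp) (fun a => ?_) a
      refine Fin.cases (by simp) (fun b => ?_) b
      rw [← param_comp_succAbove_zero p hs, ← edge_comp_succAbove_zero,
        ← edge_comp_succAbove_zero]
      exact heval _ _ _ _
    have h0 : edge p 0 ⬝ᵥ evalField F (param p s) *ᵥ edge p 0 = 0 :=
      self_eq_neg.1 (hskew _ _ _)
    have h1 := key a b
    have h2 := key b c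
    have h3 := key c a
    simp only [mulVec_sub, dotProduct_sub, sub_dotProduct, h0] at h1 h2 h3
    rw [hskew _ (edge p a) (edge p 0)] at h1
    rw [hskew _ (edge p b) (edge p 0)] at h2
    rw [hskew _ (edge p c) (edge p 0)] at h3
    simp only [map_add, eval_pull]
    linarith

/-- One step up in dimension: a trimmed 2-form whose pullbacks to the facets of a simplex vanish,
and whose interior moments on the simplex vanish, has vanishing pullback to the simplex. -/
lemma pull_eq_zero {k : ℤ} {F : MatrixField} (hF : IsTrimmed k F)
    (p : Fin (d + 2) → Fin 4 → ℝ) (h : ∀ i : Fin (d + 2), pull (p ∘ i.succAbove) F = 0)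
    (hmom : ∀ a b, ∀ q ∈ polySpace (d + 1) (k - d),
      polyIntegral (d + 1) (pull p F a b * q) = 0) : pull p F = 0 := by
  refine (hF.pull p).eq_zero (hasZeroTrace_pull hF.skew p h) fun a b q hq => hmom a b q ?_
  rwa [show k + 1 - ((d + 1 : ℕ) : ℤ) = k - d by push_cast; ring] at hq

/-- Base of the induction on dimension: an edge carries no nonzero 2-form, so triangles need no
trace conditions. -/
lemma IsTrimmed.pull_one_eq_zero {k : ℤ} {F : MatrixField} (hF : IsTrimmed k F)
    (p : Fin 2 → Fin 4 → ℝ) : Pentatope.pull p F = 0 := by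
  ext1 a b
  rw [Subsingleton.elim b a, (hF.pull p).diag, Matrix.zero_apply]

/-! ### The trace in terms of edge vectors -/

lemma linearIndependent_edge {v : Fin 5 → Fin 4 → ℝ} (hv : AffineIndependent ℝ v)
    (f : Fin (d + 1) ↪ Fin 5) : LinearIndependent ℝ (edge (v ∘ f)) := by
  have h := (affineIndependent_iff_linearIndependent_vsub ℝ _ 0).1 (hv.comp_embedding f)
  have hinj : Function.Injective
      (fun a : Fin d => (⟨a.succ, Fin.succ_ne_zero a⟩ : {x : Fin (d + 1) // x ≠ 0})) :=
    fun a b hab => Fin.succ_injective _ (congrArg Subtype.val hab)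
  have h2 := h.comp _ hinj
  rw [Fintype.linearIndependent_iff] at h2 ⊢
  exact fun g hg => h2 g hg

/-- The Kronecker symbol on `Fin 4`. -/
def kron (x y : Fin 4) : ℤ := if x = y then 1 else 0

/-- The minor of the integer matrix with rows the unit vectors `eⱼ, eₖ, eₗ`, in the columns
`a, b, c`. -/
def unitMinor (j k l a b c : Fin 4) : ℤ :=
  kron j a * (kron k b * kron l c - kron k c * kron l b) -
    kron j b * (kron k a * kron l c - kron k c * kron l a) +
    kron j c * (kron k a * kron l b - kron k b * kron l a)

/-- Moves the real determinant into integer arithmetic, where identities over all indices are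
decidable. -/
lemma leviCivita_eq_unitMinor (i j k l : Fin 4) : leviCivita i j k l =
    ((kron i 0 * unitMinor j k l 1 2 3 - kron i 1 * unitMinor j k l 0 2 3 +
      kron i 2 * unitMinor j k l 0 1 3 - kron i 3 * unitMinor j k l 0 1 2 : ℤ) : ℝ) := by
  have h : ∀ x y : Fin 4, (if x = y then (1 : ℝ) else 0) = kron x y := fun x y => by simp [kron]
  simp only [leviCivita, h, det_succ_row_zero, Fin.sum_univ_succ, unitMinor]
  simp [Fin.succAbove]
  ring

/-- The Vandermonde product of the indices is alternating and equals 12 on $(0,1,2,3)$, so the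
integer division is exact. -/
lemma leviCivita_eq (i j k l : Fin 4) : leviCivita i j k l =
    (((j : ℤ) - i) * ((k : ℤ) - i) * ((l : ℤ) - i) * ((k : ℤ) - j) * ((l : ℤ) - j) *
      ((l : ℤ) - k) / 12 : ℤ) := by
  rw [leviCivita_eq_unitMinor]
  congr 1
  revert i j k l
  decide

lemma cross_eq {n : Fin 4 → ℝ} {M : Matrix (Fin 4) (Fin 4) ℝ} (hM : ∀ i j, M i j = -M j i) :
    cross n M = ![2 * (n 1 * M 2 3 - n 2 * M 1 3 + n 3 * M 1 2),
      2 * (-n 0 * M 2 3 + n 2 * M 0 3 - n 3 * M 0 2),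
      2 * (n 0 * M 1 3 - n 1 * M 0 3 + n 3 * M 0 1),
      2 * (-n 0 * M 1 2 + n 1 * M 0 2 - n 2 * M 0 1)] := by
  ext i
  fin_cases i <;> simp [cross, Fin.sum_univ_four, leviCivita_eq, hM 1 0, hM 2 0, hM 3 0, hM 2 1,
    hM 3 1, hM 3 2] <;> ring

/-- The cross product of three vectors in `ℝ⁴`. -/
def cross3 (e : Fin 3 → Fin 4 → ℝ) : Fin 4 → ℝ := fun j =>
  det (of ![Pi.single j 1, e 0, e 1, e 2])

lemma cross3_dotProduct (e : Fin 3 → Fin 4 → ℝ) (x : Fin 4 → ℝ) :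
    cross3 e ⬝ᵥ x = det (of ![x, e 0, e 1, e 2]) := by
  simp [cross3, dotProduct, det_succ_row_zero, Fin.sum_univ_succ, Fin.succAbove]
  ring

lemma cross3_dotProduct_self (e : Fin 3 → Fin 4 → ℝ) (a : Fin 3) : cross3 e ⬝ᵥ e a = 0 := by
  rw [cross3_dotProduct]
  refine det_zero_of_row_eq (i := 0) (j := a.succ) (Fin.succ_ne_zero a).symm ?_
  fin_cases a <;> rfl

lemma dotProduct_mulVec_fin_four (M : Matrix (Fin 4) (Fin 4) ℝ) (u w : Fin 4 → ℝ) :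
    u ⬝ᵥ M *ᵥ w = ∑ i, ∑ j, u i * M i j * w j := by
  simp only [dotProduct, mulVec, Finset.mul_sum, mul_assoc]

/-- Crossing `M` with the normal to `e` contracts `M` with the trivector $e_0\wedge e_1\wedge e_2$.
The trace thus depends only on the values of `M` on pairs of tangent vectors. -/
lemma cross_cross3 (e : Fin 3 → Fin 4 → ℝ) {M : Matrix (Fin 4) (Fin 4) ℝ}
    (hM : ∀ i j, M i j = -M j i) : cross (cross3 e) M =
      (-2 : ℝ) • ((e 1 ⬝ᵥ M *ᵥ e 2) • e 0 + (e 2 ⬝ᵥ M *ᵥ e 0) • e 1 +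
        (e 0 ⬝ᵥ M *ᵥ e 1) • e 2) := by
  have hd : ∀ i, M i i = 0 := fun i => self_eq_neg.1 (hM i i)
  rw [cross_eq hM]
  ext i
  fin_cases i <;> simp [cross3, det_succ_row_zero, Fin.sum_univ_succ, Fin.succAbove,
    dotProduct_mulVec_fin_four, hM 1 0, hM 2 0, hM 3 0, hM 2 1, hM 3 1, hM 3 2, hd] <;> ring

lemma cross_smul_left (c : ℝ) (n : Fin 4 → ℝ) (M : Matrix (Fin 4) (Fin 4) ℝ) :
    cross (c • n) M = c • cross n M := by
  ext i
  simp only [cross, Pi.smul_apply, smul_eq_mul, Finset.mul_sum]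
  refine Finset.sum_congr rfl fun j _ => Finset.sum_congr rfl fun k _ =>
    Finset.sum_congr rfl fun l _ => ?_
  ring

lemma linearIndependent_cons_of_orthogonal {e : Fin 3 → Fin 4 → ℝ} (he : LinearIndependent ℝ e)
    {n : Fin 4 → ℝ} (hn : n ≠ 0) (hne : ∀ a, n ⬝ᵥ e a = 0) :
    LinearIndependent ℝ (Fin.cons n e : Fin 4 → Fin 4 → ℝ) := by
  refine linearIndependent_finCons.2 ⟨he, fun hmem => hn ?_⟩
  have h : ∀ x ∈ Submodule.span ℝ (Set.range e), n ⬝ᵥ x = 0 := by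
    intro x hx
    induction hx using Submodule.span_induction with
    | mem x hx => obtain ⟨a, rfl⟩ := hx; exact hne a
    | zero => simp
    | add x y _ _ hx hy => rw [dotProduct_add, hx, hy, add_zero]
    | smul c x _ hx => rw [dotProduct_smul, hx, smul_zero]
  exact dotProduct_self_eq_zero.1 (h n hmem)

/-- Vectors orthogonal to three independent vectors and to a nonzero common normal vanish. -/
lemma eq_zero_of_orthogonal {e : Fin 3 → Fin 4 → ℝ} (he : LinearIndependent ℝ e)
    {n : Fin 4 → ℝ} (hn : n ≠ 0) (hne : ∀ a, n ⬝ᵥ e a = 0) {y : Fin 4 → ℝ}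
    (hy : n ⬝ᵥ y = 0) (hye : ∀ a, e a ⬝ᵥ y = 0) : y = 0 := by
  have h := linearIndependent_cons_of_orthogonal he hn hne
  have hdet : IsUnit (of (Fin.cons n e : Fin 4 → Fin 4 → ℝ)) :=
    Matrix.linearIndependent_rows_iff_isUnit.1 h
  rw [Matrix.isUnit_iff_isUnit_det, isUnit_iff_ne_zero] at hdet
  refine Matrix.eq_zero_of_mulVec_eq_zero hdet (funext fun i => ?_)
  refine Fin.cases hy (fun a => hye a) i

/-- The trace of a 2-form on a hyperplane, in terms of a basis of the hyperplane. -/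
lemma exists_cross_eq {e : Fin 3 → Fin 4 → ℝ} (he : LinearIndependent ℝ e)
    {n : Fin 4 → ℝ} (hn : n ≠ 0) (hne : ∀ a, n ⬝ᵥ e a = 0) :
    ∃ c : ℝ, c ≠ 0 ∧ ∀ M : Matrix (Fin 4) (Fin 4) ℝ, (∀ i j, M i j = -M j i) →
      cross n M = c • ((e 1 ⬝ᵥ M *ᵥ e 2) • e 0 + (e 2 ⬝ᵥ M *ᵥ e 0) • e 1 +
        (e 0 ⬝ᵥ M *ᵥ e 1) • e 2) := by
  set m := cross3 e with hm
  have hnn : n ⬝ᵥ n ≠ 0 := fun h => hn (dotProduct_self_eq_zero.1 h)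
  -- Otherwise $m$ is orthogonal to a basis and vanishes, although $m\cdot n$ is the determinant of
  -- the basis $n,e_0,e_1,e_2$.
  have hmn : m ⬝ᵥ n ≠ 0 := by
    intro h
    have h0 : m = 0 := eq_zero_of_orthogonal he hn hne (by rwa [dotProduct_comm])
      fun a => by rw [dotProduct_comm, hm, cross3_dotProduct_self]
    have h1 := linearIndependent_cons_of_orthogonal he hn hne
    have hdet : IsUnit (of (Fin.cons n e : Fin 4 → Fin 4 → ℝ)) :=
      Matrix.linearIndependent_rows_iff_isUnit.1 h1
    rw [Matrix.isUnit_iff_isUnit_det, isUnit_iff_ne_zero] at hdet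
    refine hdet ?_
    have h2 := cross3_dotProduct e n
    rw [← hm, h0, zero_dotProduct] at h2
    rw [h2]
    congr 2
    ext i : 1
    fin_cases i <;> rfl
  have hpar : (m ⬝ᵥ n) • n - (n ⬝ᵥ n) • m = 0 := by
    refine eq_zero_of_orthogonal he hn hne ?_ fun a => ?_
    · rw [dotProduct_sub, dotProduct_smul, dotProduct_smul, dotProduct_comm n m, smul_eq_mul,
        smul_eq_mul]
      ring
    · rw [dotProduct_sub, dotProduct_smul, dotProduct_smul, dotProduct_comm (e a) n, hne,
        dotProduct_comm (e a) m, hm, cross3_dotProduct_self]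
      simp
  have hn' : n = ((n ⬝ᵥ n) / (m ⬝ᵥ n)) • m := by
    rw [sub_eq_zero] at hpar
    rw [div_eq_inv_mul, mul_smul, ← hpar, smul_smul, inv_mul_cancel₀ hmn, one_smul]
  refine ⟨(n ⬝ᵥ n) / (m ⬝ᵥ n) * -2, mul_ne_zero (div_ne_zero hnn hmn) (by norm_num),
    fun M hM => ?_⟩
  conv_lhs => rw [hn']
  rw [cross_smul_left, hm, cross_cross3 e hM, smul_smul]

/-! ### The Gram matrix of a simplex -/

/-- The Gram matrix of the edge vectors. -/
def edgeGram (p : Fin (d + 1) → Fin 4 → ℝ) : Matrix (Fin d) (Fin d) ℝ :=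
  Matrix.of fun a b => edge p a ⬝ᵥ edge p b

lemma det_edgeGram_pos {p : Fin (d + 1) → Fin 4 → ℝ} (hp : LinearIndependent ℝ (edge p)) :
    0 < (edgeGram p).det := by
  have h : edgeGram p = of (edge p) * (of (edge p))ᴴ := by
    ext a b
    simp [edgeGram, Matrix.mul_apply, dotProduct]
  rw [h]
  refine (Matrix.PosDef.mul_conjTranspose_self _ ?_).det_pos
  exact Matrix.vecMul_injective_iff.2 hp

lemma simplexIntegral_eq (p : Fin (d + 1) → Fin 4 → ℝ) {h : (Fin d → ℝ) → ℝ}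
    {q : MvPolynomial (Fin d) ℝ} (hq : ∀ s, h s = eval s q) :
    simplexIntegral p h = √(edgeGram p).det * polyIntegral d q := by
  simp only [simplexIntegral, hq, polyIntegral_apply, edgeGram]

/-! ### The moments in terms of the pullbacks -/

lemma evalField_skew {F : MatrixField} (hF : ∀ i j, F i j = -F j i) (x : Fin 4 → ℝ) (i j : Fin 4) :
    evalField F x i j = -evalField F x j i := by
  simp [evalField, hF i j]

lemma UnitNormals.n_ne_zero {v : Fin 5 → Fin 4 → ℝ} (N : UnitNormals v) (𝓕 : Sub 3) :
    N.n 𝓕 ≠ 0 := by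
  intro h
  have := N.n_unit 𝓕
  simp [h] at this

/-- Since $\nu$ is orthogonal to the two edges of $f$, only the third edge component of the trace
survives, and its coefficient is the pullback to $f$. The chosen facet and normals affect only the
nonzero constant. -/
lemma exists_faceMoment_eq {v : Fin 5 → Fin 4 → ℝ} (hv : AffineIndependent ℝ v)
    (N : UnitNormals v) (f : Sub 2) : ∃ c : ℝ, c ≠ 0 ∧ ∀ F : MatrixField,
      (∀ i j, F i j = -F j i) → ∀ q, faceMoment N f F q =
        c * polyIntegral 2 (pull (v ∘ f) F 0 1 * q) := by
  classical
  set 𝓕 := N.facet f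
  obtain ⟨x, hx𝓕, hxf⟩ : ∃ x ∈ Finset.univ.map 𝓕.toEmbedding, x ∉ Finset.univ.map f.toEmbedding :=
    Finset.exists_mem_notMem_of_card_lt_card (by simp)
  simp only [Finset.mem_map, Finset.mem_univ, true_and, RelEmbedding.coe_toEmbedding,
    not_exists] at hx𝓕 hxf
  -- Listing the extra facet vertex last keeps the edges of the face as the first two edges of the
  -- facet.
  have hg : Function.Injective (Fin.snoc (f : Fin 3 → Fin 5) x : Fin 4 → Fin 5) :=
    Fin.snoc_injective_iff.2 ⟨f.injective, fun ⟨a, ha⟩ => hxf a ha⟩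
  set g : Fin 4 ↪ Fin 5 := ⟨Fin.snoc (f : Fin 3 → Fin 5) x, hg⟩
  have hgF : ∀ i, ∃ a, 𝓕 a = g i := by
    intro i
    have hs := N.face_subset f
    fin_cases i
    · exact hs ⟨0, rfl⟩
    · exact hs ⟨1, rfl⟩
    · exact hs ⟨2, rfl⟩
    · exact hx𝓕
  have he := linearIndependent_edge hv g
  have hne : ∀ a, N.n 𝓕 ⬝ᵥ edge (v ∘ g) a = 0 := by
    intro a
    obtain ⟨y, hy⟩ := hgF a.succ
    obtain ⟨z, hz⟩ := hgF 0
    rw [edge, Function.comp_apply, Function.comp_apply, ← hy, ← hz]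
    exact N.n_normal 𝓕 y z
  have e0 : edge (v ∘ g) 0 = edge (v ∘ f) 0 := rfl
  have e1 : edge (v ∘ g) 1 = edge (v ∘ f) 1 := rfl
  have hν : ∀ a, edge (v ∘ f) a ⬝ᵥ N.ν f = 0 := fun a => by
    rw [dotProduct_comm]; exact N.ν_normal f a.succ 0
  have hν2 : edge (v ∘ g) 2 ⬝ᵥ N.ν f ≠ 0 := by
    intro h
    have h0 : N.ν f = 0 := by
      refine eq_zero_of_orthogonal he (N.n_ne_zero 𝓕) hne ?_ fun a => ?_
      · rw [dotProduct_comm]; exact N.ν_tangent f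
      · fin_cases a
        · exact hν 0
        · exact hν 1
        · exact h
    have := N.ν_unit f
    simp [h0] at this
  obtain ⟨c, hc, hcross⟩ := exists_cross_eq he (N.n_ne_zero 𝓕) hne
  have hdet := det_edgeGram_pos (linearIndependent_edge hv f.toEmbedding)
  refine ⟨√(edgeGram (v ∘ f)).det * (c * (edge (v ∘ g) 2 ⬝ᵥ N.ν f)),
    mul_ne_zero (Real.sqrt_pos.2 hdet).ne' (mul_ne_zero hc hν2), fun F hF q => ?_⟩
  rw [faceMoment, simplexIntegral_eq (q := (c * (edge (v ∘ g) 2 ⬝ᵥ N.ν f)) •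
    (pull (v ∘ f) F 0 1 * q)), map_smul, smul_eq_mul]
  · ring
  intro s
  rw [hcross _ (evalField_skew hF _), smul_eval, map_mul, eval_pull, smul_dotProduct,
    add_dotProduct, add_dotProduct, smul_dotProduct, smul_dotProduct, smul_dotProduct, e0, e1,
    hν, hν]
  simp only [smul_eq_mul]
  ring

/-- The components of a 2-form in three variables, as a vector. -/
def twoFormVec (G : Matrix (Fin 3) (Fin 3) (MvPolynomial (Fin 3) ℝ)) :
    Fin 3 → MvPolynomial (Fin 3) ℝ := ![G 1 2, G 2 0, G 0 1]

/-- Both the trace and the test field are expanded in the edge basis, which is not orthonormal; the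
Gram matrix records their pairing. -/
lemma exists_facetMoment_eq {v : Fin 5 → Fin 4 → ℝ} (hv : AffineIndependent ℝ v)
    (N : UnitNormals v) (𝓕 : Sub 3) : ∃ c : ℝ, c ≠ 0 ∧ ∀ F : MatrixField,
      (∀ i j, F i j = -F j i) → ∀ q, facetMoment N 𝓕 F q =
        c * polyIntegral 3 (∑ b, twoFormVec (pull (v ∘ 𝓕) F) b *
          ∑ a, edgeGram (v ∘ 𝓕) b a • q a) := by
  have he := linearIndependent_edge hv 𝓕.toEmbedding
  have hne : ∀ a, N.n 𝓕 ⬝ᵥ edge (v ∘ 𝓕) a = 0 := fun a => N.n_normal 𝓕 a.succ 0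
  obtain ⟨c, hc, hcross⟩ := exists_cross_eq he (N.n_ne_zero 𝓕) hne
  have hdet := det_edgeGram_pos he
  refine ⟨√(edgeGram (v ∘ 𝓕)).det * c, mul_ne_zero (Real.sqrt_pos.2 hdet).ne' hc,
    fun F hF q => ?_⟩
  rw [facetMoment, simplexIntegral_eq (q := c • ∑ b, twoFormVec (pull (v ∘ 𝓕) F) b *
          ∑ a, edgeGram (v ∘ 𝓕) b a • q a), map_smul, smul_eq_mul]
  · ring
  intro s
  have h := hcross _ (evalField_skew hF (param (v ∘ 𝓕) s))
  simp only [RelEmbedding.coe_toEmbedding] at h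
  rw [h]
  simp only [twoFormVec, edgeGram, Fin.sum_univ_three, smul_eval, map_add, map_mul, eval_pull,
    smul_dotProduct, add_dotProduct, dotProduct_add, dotProduct_smul, smul_eq_mul, of_apply,
    cons_val_zero, cons_val_one, cons_val]
  ring

lemma convex_unitSimplex (d : ℕ) : Convex ℝ (unitSimplex d) := by
  intro s hs t ht a b ha hb hab
  refine ⟨fun i => add_nonneg (mul_nonneg ha (hs.1 i)) (mul_nonneg hb (ht.1 i)), ?_⟩
  simp only [Pi.add_apply, Pi.smul_apply, smul_eq_mul, Finset.sum_add_distrib, ← Finset.mul_sum]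
  nlinarith [mul_le_mul_of_nonneg_left hs.2 ha, mul_le_mul_of_nonneg_left ht.2 hb]

lemma param_eq (p : Fin (d + 1) → Fin 4 → ℝ) (s : Fin d → ℝ) :
    param p s = p 0 + Fintype.linearCombination ℝ (edge p) s := rfl

lemma convexHull_range_eq_image_param (p : Fin (d + 1) → Fin 4 → ℝ) :
    convexHull ℝ (Set.range p) = param p '' unitSimplex d := by
  refine Set.Subset.antisymm (convexHull_min ?_ ?_) ?_
  · rintro _ ⟨i, rfl⟩
    refine Fin.cases ⟨0, ⟨by simp, by simp⟩, by simp [param]⟩ (fun a => ?_) i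
    refine ⟨Pi.single a 1, ⟨fun b => ?_, by simp⟩, ?_⟩
    · by_cases h : b = a <;> simp [h]
    · simp [param_eq, Fintype.linearCombination_apply_single, edge]
  · have h : param p '' unitSimplex d =
        p 0 +ᵥ (Fintype.linearCombination ℝ (edge p) '' unitSimplex d) := by
      rw [← Set.image_vadd, Set.image_image]
      rfl
    rw [h]
    exact ((convex_unitSimplex d).linear_image _).vadd _
  · rintro _ ⟨s, hs, rfl⟩
    refine mem_convexHull_of_exists_fintype (Fin.cons (1 - ∑ a, s a) s : Fin (d + 1) → ℝ) p
      (fun i => ?_) ?_ (fun i => Set.mem_range_self i) ?_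
    · refine Fin.cases ?_ (fun a => ?_) i
      · simpa using hs.2
      · simpa using hs.1 a
    · simp [Fin.sum_univ_succ]
    · simp only [Fin.sum_univ_succ, Fin.cons_zero, Fin.cons_succ, param, edge, smul_sub,
        Finset.sum_sub_distrib, ← Finset.sum_smul, sub_smul, one_smul]
      abel

lemma exists_integral_convexHull_eq {v : Fin 5 → Fin 4 → ℝ} (hv : AffineIndependent ℝ v) :
    ∃ c : ℝ, c ≠ 0 ∧ ∀ p : MvPolynomial (Fin 4) ℝ,
      ∫ x in convexHull ℝ (Set.range v), eval x p =
        c * polyIntegral 4 (aeval (paramPoly v) p) := by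
  have he : LinearIndependent ℝ (edge v) := linearIndependent_edge hv (Function.Embedding.refl _)
  set L : (Fin 4 → ℝ) →ₗ[ℝ] (Fin 4 → ℝ) := Fintype.linearCombination ℝ (edge v) with hL
  have hinj : Function.Injective L := he.fintypeLinearCombination_injective
  have hdet : LinearMap.det L ≠ 0 := by
    have h := (LinearEquiv.ofInjectiveEndo L hinj).isUnit_det'
    exact h.ne_zero
  have hder : ∀ s ∈ unitSimplex 4, HasFDerivWithinAt (param v)
      (LinearMap.toContinuousLinearMap L) (unitSimplex 4) s := fun s _ =>
    ((LinearMap.toContinuousLinearMap L).hasFDerivAt.const_add (v 0)).hasFDerivWithinAt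
  have hpinj : Function.Injective (param v) := fun s t hst => hinj (add_left_cancel hst)
  refine ⟨|LinearMap.det L|, abs_ne_zero.2 hdet, fun p => ?_⟩
  rw [convexHull_range_eq_image_param, integral_image_eq_integral_abs_det_fderiv_smul volume
    (measurableSet_unitSimplex 4) hder hpinj.injOn]
  simp only [smul_eq_mul, integral_const_mul, polyIntegral_apply, eval_aeval_paramPoly]
  rfl

lemma exists_volumeMoment_eq {v : Fin 5 → Fin 4 → ℝ} (hv : AffineIndependent ℝ v) :
    ∃ c : ℝ, c ≠ 0 ∧ ∀ F w, volumeMoment v F w =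
      c * polyIntegral 4 (aeval (paramPoly v) (∑ i, ∑ j, F i j * skew w i j)) := by
  obtain ⟨c, hc, h⟩ := exists_integral_convexHull_eq hv
  refine ⟨c, hc, fun F w => ?_⟩
  rw [← h]
  simp [volumeMoment, evalField]

/-- The affine coordinates of a pentatope, as polynomials. -/
def invParamPoly (v : Fin 5 → Fin 4 → ℝ) (a : Fin 4) : MvPolynomial (Fin 4) ℝ :=
  ∑ i, C ((of (edge v))⁻¹ i a) * (X i - C (v 0 i))

lemma invParamPoly_mem_polySpace (v : Fin 5 → Fin 4 → ℝ) (a : Fin 4) :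
    invParamPoly v a ∈ polySpace 4 1 :=
  Submodule.sum_mem _ fun i _ => C_mul_mem_polySpace _ (Submodule.sub_mem _ (X_mem_polySpace i)
    (polySpace_mono zero_le_one (C_mem_polySpace _)))

lemma eval_param_invParamPoly {v : Fin 5 → Fin 4 → ℝ} (hv : AffineIndependent ℝ v)
    (s : Fin 4 → ℝ) (a : Fin 4) : eval (param v s) (invParamPoly v a) = s a := by
  have he : LinearIndependent ℝ (edge v) := linearIndependent_edge hv (Function.Embedding.refl _)
  have hunit : IsUnit (of (edge v)).det := by
    rw [← Matrix.isUnit_iff_isUnit_det]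
    exact Matrix.linearIndependent_rows_iff_isUnit.1 he
  have h1 : ∀ i, param v s i - v 0 i = (s ᵥ* of (edge v)) i := fun i => by
    simp [param, vecMul, dotProduct]
  have h2 : eval (param v s) (invParamPoly v a) = ((s ᵥ* of (edge v)) ᵥ* (of (edge v))⁻¹) a := by
    simp only [invParamPoly, map_sum, map_mul, map_sub, eval_C, eval_X, h1]
    simp only [vecMul, dotProduct]
    exact Finset.sum_congr rfl fun i _ => mul_comm _ _
  rw [h2, vecMul_vecMul, Matrix.mul_nonsing_inv _ hunit, vecMul_one]

lemma aeval_paramPoly_aeval_invParamPoly {v : Fin 5 → Fin 4 → ℝ} (hv : AffineIndependent ℝ v)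
    (q : MvPolynomial (Fin 4) ℝ) : aeval (paramPoly v) (aeval (invParamPoly v) q) = q := by
  refine MvPolynomial.funext fun s => ?_
  rw [eval_aeval_paramPoly, eval_aeval]
  simp only [eval_param_invParamPoly hv]

/-! ### Vanishing moments force a trimmed 2-form to vanish -/

section Vanishing

variable {v : Fin 5 → Fin 4 → ℝ} {k : ℤ} {F : MatrixField}

lemma pull_face_eq_zero (hv : AffineIndependent ℝ v) (N : UnitNormals v) (hF : IsTrimmed k F)
    (f : Sub 2) (h : ∀ q ∈ polySpace 2 (k - 1), faceMoment N f F q = 0) :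
    pull (v ∘ f) F = 0 := by
  obtain ⟨c, hc, hmom⟩ := exists_faceMoment_eq hv N f
  have h01 : ∀ q ∈ polySpace 2 (k - 1), polyIntegral 2 (pull (v ∘ f) F 0 1 * q) = 0 :=
    fun q hq => (mul_eq_zero.1 ((hmom F hF.skew q).symm.trans (h q hq))).resolve_left hc
  have hG := hF.pull (v ∘ f)
  refine pull_eq_zero hF (v ∘ f) (fun i => hF.pull_one_eq_zero _) fun a b q hq => ?_
  replace hq : q ∈ polySpace 2 (k - 1) := by simpa using hq
  fin_cases a <;> fin_cases b
  · simp [hG.diag]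
  · exact h01 q hq
  · simpa [hG.skew 1 0] using h01 q hq
  · simp [hG.diag]

lemma pull_facet_eq_zero (hv : AffineIndependent ℝ v) (N : UnitNormals v) (hF : IsTrimmed k F)
    (𝓕 : Sub 3) (hface : ∀ f : Sub 2, pull (v ∘ f) F = 0)
    (h : ∀ q : Fin 3 → MvPolynomial (Fin 3) ℝ, (∀ a, q a ∈ polySpace 3 (k - 2)) →
      facetMoment N 𝓕 F q = 0) : pull (v ∘ 𝓕) F = 0 := by
  obtain ⟨c, hc, hmom⟩ := exists_facetMoment_eq hv N 𝓕
  have hdet := det_edgeGram_pos (linearIndependent_edge hv 𝓕.toEmbedding)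
  have hvec : ∀ b, ∀ q ∈ polySpace 3 (k - 2),
      polyIntegral 3 (twoFormVec (pull (v ∘ 𝓕) F) b * q) = 0 := by
    intro b q hq
    -- A column of the inverse Gram matrix as test direction isolates one component of the pullback.
    have h1 := (hmom F hF.skew _).symm.trans
      (h (fun a => (edgeGram (v ∘ 𝓕))⁻¹ a b • q) fun a => Submodule.smul_mem _ _ hq)
    have h2 : ∀ b', ∑ a, edgeGram (v ∘ 𝓕) b' a • (edgeGram (v ∘ 𝓕))⁻¹ a b • q =
        (1 : Matrix (Fin 3) (Fin 3) ℝ) b' b • q := fun b' => by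
      rw [← Matrix.mul_nonsing_inv (edgeGram (v ∘ 𝓕)) (isUnit_iff_ne_zero.2 hdet.ne'),
        Matrix.mul_apply, Finset.sum_smul]
      simp only [mul_smul]
    simp only [h2, Matrix.one_apply, ite_smul, one_smul, zero_smul, mul_ite, mul_zero,
      Finset.sum_ite_eq', Finset.mem_univ, if_true] at h1
    exact (mul_eq_zero.1 h1).resolve_left hc
  have hG := hF.pull (v ∘ 𝓕)
  refine pull_eq_zero hF (v ∘ 𝓕) (fun i => hface ((Fin.succAboveOrderEmb i).trans 𝓕))
    fun a b q hq => ?_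
  replace hq : q ∈ polySpace 3 (k - 2) := by simpa using hq
  have h12 : polyIntegral 3 (pull (v ∘ 𝓕) F 1 2 * q) = 0 := hvec 0 q hq
  have h20 : polyIntegral 3 (pull (v ∘ 𝓕) F 2 0 * q) = 0 := hvec 1 q hq
  have h01 : polyIntegral 3 (pull (v ∘ 𝓕) F 0 1 * q) = 0 := hvec 2 q hq
  fin_cases a <;> fin_cases b
  · simp [hG.diag]
  · exact h01
  · simpa [hG.skew 0 2] using h20
  · simpa [hG.skew 1 0] using h01
  · simp [hG.diag]
  · exact h12
  · exact h20
  · simpa [hG.skew 2 1] using h12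
  · simp [hG.diag]

lemma skew_apply_of_skew {Q : MatrixField} (hQ : ∀ i j, Q i j = -Q j i) :
    skew ![Q 0 1, Q 0 2, Q 0 3, Q 1 2, Q 1 3, Q 2 3] = Q := by
  have hd : ∀ i, Q i i = 0 := fun i => self_eq_neg.1 (hQ i i)
  ext1 i j
  fin_cases i <;> fin_cases j <;>
    simp [skew, hd, hQ 1 0, hQ 2 0, hQ 3 0, hQ 2 1, hQ 3 1, hQ 3 2]

lemma pull_eq_zero_of_volumeMoment (hv : AffineIndependent ℝ v) (hF : IsTrimmed k F)
    (hfacet : ∀ 𝓕 : Sub 3, pull (v ∘ 𝓕) F = 0)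
    (h : ∀ w : Fin 6 → MvPolynomial (Fin 4) ℝ, (∀ a, w a ∈ polySpace 4 (k - 3)) →
      volumeMoment v F w = 0) : pull v F = 0 := by
  obtain ⟨c, hc, hmom⟩ := exists_volumeMoment_eq hv
  refine pull_eq_zero hF v (fun i => hfacet (Fin.succAboveOrderEmb i)) fun a b q hq => ?_
  replace hq : q ∈ polySpace 4 (k - 3) := by simpa using hq
  have hq' : aeval (invParamPoly v) q ∈ polySpace 4 (k - 3) :=
    aeval_mem_polySpace (invParamPoly_mem_polySpace v) hq
  -- The skew part of $e_ae_b^T$, with `q` rewritten in the coordinates of $\mathbb{R}^4$: the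
  -- pairing $F:Q$ pulls back to twice $G_{ab}q$.
  set Q : MatrixField := Matrix.of fun i j =>
    C (edge v a i * edge v b j - edge v a j * edge v b i) * aeval (invParamPoly v) q with hQ
  have hskew : ∀ i j, Q i j = -Q j i := fun i j => by
    simp only [hQ, Matrix.of_apply, map_sub, map_mul]; ring
  have hw : ∀ i, ![Q 0 1, Q 0 2, Q 0 3, Q 1 2, Q 1 3, Q 2 3] i ∈ polySpace 4 (k - 3) := by
    intro i
    fin_cases i <;> exact C_mul_mem_polySpace _ hq'
  have h1 := (mul_eq_zero.1 ((hmom F _).symm.trans (h _ hw))).resolve_left hc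
  rw [skew_apply_of_skew hskew] at h1
  have h2 : aeval (paramPoly v) (∑ i, ∑ j, F i j * Q i j) = (2 : ℝ) • (pull v F a b * q) := by
    have h3 : ∑ i, ∑ j, C (edge v a j * edge v b i) * aeval (paramPoly v) (F i j) =
        -pull v F a b := by
      rw [← (hF.pull v).skew, pull_apply]
      simp only [mul_comm]
    have h4 : aeval (paramPoly v) (∑ i, ∑ j, F i j * Q i j) = (pull v F a b -
        ∑ i, ∑ j, C (edge v a j * edge v b i) * aeval (paramPoly v) (F i j)) * q := by
      simp only [map_sum, map_mul, hQ, Matrix.of_apply, algHom_C, algebraMap_eq,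
        aeval_paramPoly_aeval_invParamPoly hv, pull_apply, ← Finset.sum_sub_distrib,
        Finset.sum_mul, map_sub]
      refine Finset.sum_congr rfl fun i _ => Finset.sum_congr rfl fun j _ => ?_
      ring
    rw [h4, h3, two_smul]
    ring
  rw [h2, map_smul, smul_eq_mul] at h1
  exact (mul_eq_zero.1 h1).resolve_left two_ne_zero

/-- At each point the pullback is $EFE^T$, where the edge matrix $E$ is invertible, and the affine
coordinates reach all of $\mathbb{R}^4$. -/
lemma eq_zero_of_pull_eq_zero (hv : AffineIndependent ℝ v) (h : pull v F = 0) : F = 0 := by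
  have he : LinearIndependent ℝ (edge v) := linearIndependent_edge hv (Function.Embedding.refl _)
  have hunit : IsUnit (of (edge v)) := Matrix.linearIndependent_rows_iff_isUnit.1 he
  have hunitT : IsUnit (of (edge v))ᵀ := (Matrix.isUnit_transpose _).2 hunit
  have h1 : ∀ s, evalField F (param v s) = 0 := by
    intro s
    have h2 : of (edge v) * evalField F (param v s) * (of (edge v))ᵀ = 0 := by
      ext a b
      have h3 := eval_pull v F s a b
      rw [h] at h3
      rw [Matrix.mul_assoc]
      simpa [Matrix.mul_apply, dotProduct, mulVec] using h3.symm
    rw [hunitT.mul_left_eq_zero, hunit.mul_right_eq_zero] at h2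
    exact h2
  ext1 i j
  rw [Matrix.zero_apply]
  have h5 : aeval (paramPoly v) (F i j) = 0 := by
    refine MvPolynomial.funext fun s => ?_
    rw [eval_aeval_paramPoly, map_zero]
    exact congrFun (congrFun (h1 s) i) j
  refine MvPolynomial.funext fun x => ?_
  have hsurj : ∃ s, param v s = x := by
    have hs : Function.Surjective fun s => s ᵥ* of (edge v) :=
      Matrix.vecMul_surjective_iff_isUnit.2 hunit
    obtain ⟨s, hs⟩ := hs (x - v 0)
    refine ⟨s, ?_⟩
    have : param v s = v 0 + s ᵥ* of (edge v) := by
      ext i; simp [param, vecMul, dotProduct]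
    rw [this]
    simp only [] at hs
    rw [hs, add_sub_cancel]
  obtain ⟨s, rfl⟩ := hsurj
  rw [← eval_aeval_paramPoly, h5]
  simp

/-- A trimmed 2-form on a pentatope, all of whose degrees of freedom vanish, is zero. -/
theorem IsTrimmed.eq_zero_of_moments (hv : AffineIndependent ℝ v) (N : UnitNormals v)
    (hF : IsTrimmed k F)
    (hface : ∀ f : Sub 2, ∀ q ∈ polySpace 2 (k - 1), faceMoment N f F q = 0)
    (hfacet : ∀ 𝓕 : Sub 3, ∀ q : Fin 3 → MvPolynomial (Fin 3) ℝ,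
        (∀ a, q a ∈ polySpace 3 (k - 2)) → facetMoment N 𝓕 F q = 0)
    (hvol : ∀ w : Fin 6 → MvPolynomial (Fin 4) ℝ,
        (∀ a, w a ∈ polySpace 4 (k - 3)) → volumeMoment v F w = 0) : F = 0 :=
  eq_zero_of_pull_eq_zero hv <| pull_eq_zero_of_volumeMoment hv hF
    (fun 𝓕 => pull_facet_eq_zero hv N hF 𝓕
      (fun f => pull_face_eq_zero hv N hF f (hface f)) (hfacet 𝓕)) hvol

end Vanishing

/-! ### Dimension counts -/

lemma setOf_degree_eq (d n : ℕ) : {α : Fin d →₀ ℕ | α.degree = n} =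
    (Finset.univ.finsuppAntidiag n : Finset (Fin d →₀ ℕ)) := by
  ext α
  simp [Finsupp.degree_eq_sum]

lemma ncard_degree_eq (d n : ℕ) : {α : Fin d →₀ ℕ | α.degree = n}.ncard = d.multichoose n := by
  rw [setOf_degree_eq, Set.ncard_coe_finset, Finset.card_finsuppAntidiag_nat_eq_multichoose,
    Finset.card_univ, Fintype.card_fin]

lemma setOf_degree_le (d n : ℕ) : {α : Fin d →₀ ℕ | α.degree ≤ n} =
    ((Finset.range (n + 1)).biUnion fun m =>
      (Finset.univ.finsuppAntidiag m : Finset (Fin d →₀ ℕ)) : Finset (Fin d →₀ ℕ)) := by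
  ext α
  simp [Finsupp.degree_eq_sum]

lemma ncard_degree_le (d n : ℕ) :
    {α : Fin d →₀ ℕ | α.degree ≤ n}.ncard = (d + 1).multichoose n := by
  rw [setOf_degree_le, Set.ncard_coe_finset, Finset.card_biUnion]
  · simp only [Finset.card_finsuppAntidiag_nat_eq_multichoose, Finset.card_univ, Fintype.card_fin]
    rw [Nat.sum_range_multichoose, Nat.multichoose_eq, show d + 1 + n - 1 = n + d by omega,
      Nat.choose_symm_add]
  · intro a _ b _ hab
    refine Finset.disjoint_left.2 fun α ha hb => hab ?_
    rw [Finset.mem_finsuppAntidiag] at ha hb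
    exact ha.1.symm.trans hb.1

lemma polySpace_eq_bot {m : ℤ} (hm : m < 0) : polySpace d m = ⊥ := by
  refine (Submodule.eq_bot_iff _).2 fun p hp => ?_
  ext α
  by_contra h
  have := mem_polySpace.1 hp α h
  omega

lemma homogSpace_eq_bot {m : ℤ} (hm : m < 0) : homogSpace d m = ⊥ :=
  le_bot_iff.1 ((homogSpace_le_polySpace m).trans (polySpace_eq_bot hm).le)

lemma finrank_polySpace_natCast (d n : ℕ) :
    Module.finrank ℝ (polySpace d n) = (d + 1).multichoose n := by
  rw [← ncard_degree_le]
  have h : {α : Fin d →₀ ℕ | (α.degree : ℤ) ≤ n} = {α | α.degree ≤ n} := by ext; simp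
  rw [← h]
  exact Module.finrank_eq_nat_card_basis (basisRestrictSupport ℝ _)

lemma finrank_homogSpace_natCast (d n : ℕ) :
    Module.finrank ℝ (homogSpace d n) = d.multichoose n := by
  rw [← ncard_degree_eq]
  have h : {α : Fin d →₀ ℕ | (α.degree : ℤ) = n} = {α | α.degree = n} := by ext; simp
  rw [← h]
  exact Module.finrank_eq_nat_card_basis (basisRestrictSupport ℝ _)

/-- In this form the binomial coefficient is zero exactly when the degree is negative, so the small
values of $k$ need no separate treatment later. -/
lemma finrank_polySpace_sub {d j : ℕ} (hj : j ≤ d) (n : ℕ) :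
    Module.finrank ℝ (polySpace d ((n : ℤ) - j)) = (n + (d - j)).choose d := by
  rcases lt_or_ge n j with h | h
  · rw [polySpace_eq_bot (by omega), finrank_bot, Nat.choose_eq_zero_of_lt (by omega)]
  · obtain ⟨m, rfl⟩ := Nat.exists_eq_add_of_le h
    rw [show ((j + m : ℕ) : ℤ) - j = (m : ℕ) by push_cast; ring, finrank_polySpace_natCast,
      Nat.multichoose_eq, show d + 1 + m - 1 = m + d by omega,
      show j + m + (d - j) = m + d by omega, Nat.choose_symm_add]

lemma finrank_homogSpace_sub {d j : ℕ} (hj : j ≤ d) (n : ℕ) :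
    Module.finrank ℝ (homogSpace (d + 1) ((n : ℤ) - j)) = (n + (d - j)).choose d := by
  rcases lt_or_ge n j with h | h
  · rw [homogSpace_eq_bot (by omega), finrank_bot, Nat.choose_eq_zero_of_lt (by omega)]
  · obtain ⟨m, rfl⟩ := Nat.exists_eq_add_of_le h
    rw [show ((j + m : ℕ) : ℤ) - j = (m : ℕ) by push_cast; ring, finrank_homogSpace_natCast,
      Nat.multichoose_eq, show d + 1 + m - 1 = m + d by omega,
      show j + m + (d - j) = m + d by omega, Nat.choose_symm_add]

instance finiteDimensional_polySpace (d : ℕ) (m : ℤ) : FiniteDimensional ℝ (polySpace d m) := by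
  have hfin : {α : Fin d →₀ ℕ | (α.degree : ℤ) ≤ m}.Finite := by
    refine Set.Finite.subset (s := {α : Fin d →₀ ℕ | α.degree ≤ m.toNat}) ?_ fun α hα => ?_
    · rw [setOf_degree_le]; exact Finset.finite_toSet _
    · have : (α.degree : ℤ) ≤ m := hα
      show α.degree ≤ m.toNat
      omega
  have := hfin.to_subtype
  exact Module.Finite.of_basis (basisRestrictSupport ℝ {α : Fin d →₀ ℕ | (α.degree : ℤ) ≤ m})

instance finiteDimensional_homogSpace (d : ℕ) (m : ℤ) : FiniteDimensional ℝ (homogSpace d m) :=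
  Submodule.finiteDimensional_of_le (homogSpace_le_polySpace m)

/-! ### The dimension of the space of 2-forms -/

lemma eq_zero_of_mem_polySpace_of_mem_homogSpace {m n : ℤ} (hmn : m < n)
    {p : MvPolynomial (Fin d) ℝ} (hp : p ∈ polySpace d m) (hp' : p ∈ homogSpace d n) : p = 0 := by
  ext α
  by_contra h
  have h1 := mem_polySpace.1 hp α h
  have h2 := mem_homogSpace.1 hp' α h
  omega

lemma X_mul_mem_homogSpace {m : ℤ} {a : Fin d} {p : MvPolynomial (Fin d) ℝ}
    (hp : p ∈ homogSpace d (m - 1)) : X a * p ∈ homogSpace d m := by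
  classical
  refine mem_homogSpace.2 fun α hα => ?_
  rw [coeff_X_mul'] at hα
  split_ifs at hα with h
  · have h1 := mem_homogSpace.1 hp _ hα
    have h2 : α - Finsupp.single a 1 + Finsupp.single a 1 = α :=
      tsub_add_cancel_of_le (Finsupp.single_le_iff.2
        (Nat.one_le_iff_ne_zero.2 (Finsupp.mem_support_iff.1 h)))
    rw [← h2, map_add, Finsupp.degree_single]
    push_cast
    omega
  · exact absurd rfl hα

lemma mem_homogSpace_of_X_mul {m : ℤ} {a : Fin d} {p : MvPolynomial (Fin d) ℝ}
    (hp : X a * p ∈ homogSpace d m) : p ∈ homogSpace d (m - 1) := by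
  refine mem_homogSpace.2 fun α hα => ?_
  rw [← coeff_X_mul α a p] at hα
  have h := mem_homogSpace.1 hp _ hα
  rw [map_add, Finsupp.degree_single] at h
  push_cast at h
  omega

/-- Exactness of the Koszul complex in the last but one place. -/
lemma exists_eq_X_mul {p : Fin (d + 2) → MvPolynomial (Fin (d + 2)) ℝ}
    (hp : ∀ i j, X j * p i = X i * p j) : ∃ q, ∀ i, p i = X i * q := by
  have h0 : X 0 ∣ p 0 := by
    have h : X 0 ∣ X 1 * p 0 := ⟨p 1, hp 0 1⟩
    refine ((X_prime (R := ℝ)).dvd_or_dvd h).resolve_left fun h1 => ?_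
    rw [X_dvd_X] at h1
    simp at h1
  obtain ⟨q, hq⟩ := h0
  refine ⟨q, fun i => ?_⟩
  have h := hp i 0
  rw [hq, mul_left_comm] at h
  exact mul_left_cancel₀ (X_ne_zero 0) h

/-- The parametrization of the space of 2-forms by its defining data. -/
def twoFormParam (n : ℤ) :
    ((Fin 6 → polySpace 4 n) × (Fin 4 → homogSpace 4 n)) →ₗ[ℝ] MatrixField :=
  LinearMap.coprod
    (skew ∘ₗ LinearMap.pi fun i => (polySpace 4 n).subtype ∘ₗ LinearMap.proj i)
    (∑ i, mulField (B i) ∘ₗ (homogSpace 4 n).subtype ∘ₗ LinearMap.proj i)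

lemma twoFormParam_apply {n : ℤ} (x : (Fin 6 → polySpace 4 n) × (Fin 4 → homogSpace 4 n)) :
    twoFormParam n x = skew (fun i => x.1 i) + ∑ i, mulField (B i) (x.2 i) := by
  simp only [twoFormParam, LinearMap.coprod_apply, LinearMap.sum_apply]
  rfl

/-- Multiplication by the position vector. -/
def koszul (n : ℤ) :
    homogSpace 4 (n - 1) →ₗ[ℝ] (Fin 6 → polySpace 4 n) × (Fin 4 → homogSpace 4 n) :=
  LinearMap.prod 0 (LinearMap.pi fun i =>
    (LinearMap.mulLeft ℝ (X i)).restrict fun _ hp => X_mul_mem_homogSpace hp)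

/-- The two summands have different degrees, so both vanish: $w=0$ and $x_jp_i=x_ip_j$, whence
$p=qx$. The inclusion alone bounds the dimension from below. -/
lemma ker_twoFormParam_le (n : ℤ) :
    LinearMap.ker (twoFormParam n) ≤ LinearMap.range (koszul n) := by
  rintro ⟨w, p⟩ hx
  rw [LinearMap.mem_ker, twoFormParam_apply] at hx
  obtain ⟨W, hW⟩ : ∃ W : Fin 6 → MvPolynomial (Fin 4) ℝ, ∀ a, W a = w a := ⟨_, fun _ => rfl⟩
  obtain ⟨P, hP⟩ : ∃ P : Fin 4 → MvPolynomial (Fin 4) ℝ, ∀ i, P i = p i := ⟨_, fun _ => rfl⟩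
  have hWmem : ∀ a, W a ∈ polySpace 4 n := fun a => hW a ▸ (w a).2
  have hPmem : ∀ i, P i ∈ homogSpace 4 n := fun i => hP i ▸ (p i).2
  simp only [← hW, ← hP] at hx
  have hent : ∀ i j, skew W i j + ∑ c, P c * B c i j = 0 := fun i j => by
    have := congrFun (congrFun hx i) j
    simpa [Matrix.sum_apply, mulField_apply] using this
  -- Each entry adds a polynomial of degree at most $n$ to one homogeneous of degree $n+1$.
  have hsplit : ∀ (a : Fin 6) (i j k l : Fin 4), W a + (X k * P i - X l * P j) = 0 →
      W a = 0 ∧ X k * P i = X l * P j := by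
    intro a i j k l h
    have hX : ∀ i k, X k * P i ∈ homogSpace 4 (n + 1) := fun i k =>
      X_mul_mem_homogSpace (by rw [add_sub_cancel_right]; exact hPmem i)
    have h2 : X k * P i - X l * P j ∈ polySpace 4 n := by
      rw [← neg_eq_of_add_eq_zero_right h]
      exact Submodule.neg_mem _ (hWmem a)
    have h3 := eq_zero_of_mem_polySpace_of_mem_homogSpace (lt_add_one n) h2
      (Submodule.sub_mem _ (hX i k) (hX j l))
    rw [h3, add_zero] at h
    exact ⟨h, sub_eq_zero.1 h3⟩
  obtain ⟨w0, h23⟩ := hsplit 0 2 3 3 2 (by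
    have := hent 0 1; simp [skew, B, Fin.sum_univ_four] at this; linear_combination this)
  obtain ⟨w1, h31⟩ := hsplit 1 3 1 1 3 (by
    have := hent 0 2; simp [skew, B, Fin.sum_univ_four] at this; linear_combination this)
  obtain ⟨w2, h12⟩ := hsplit 2 1 2 2 1 (by
    have := hent 0 3; simp [skew, B, Fin.sum_univ_four] at this; linear_combination this)
  obtain ⟨w3, h03⟩ := hsplit 3 0 3 3 0 (by
    have := hent 1 2; simp [skew, B, Fin.sum_univ_four] at this; linear_combination this)
  obtain ⟨w4, h20⟩ := hsplit 4 2 0 0 2 (by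
    have := hent 1 3; simp [skew, B, Fin.sum_univ_four] at this; linear_combination this)
  obtain ⟨w5, h01⟩ := hsplit 5 0 1 1 0 (by
    have := hent 2 3; simp [skew, B, Fin.sum_univ_four] at this; linear_combination this)
  obtain ⟨q, hq⟩ := exists_eq_X_mul (p := P) (by
    intro i j
    fin_cases i <;> fin_cases j <;>
      first | rfl | assumption | (symm; assumption))
  have hq0 : q ∈ homogSpace 4 (n - 1) := by
    refine mem_homogSpace_of_X_mul (a := 0) ?_
    rw [← hq 0]
    exact hPmem 0
  refine ⟨⟨q, hq0⟩, Prod.ext (funext fun a => Subtype.ext ?_)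
    (funext fun i => Subtype.ext ((hq i).symm.trans (hP i)))⟩
  change 0 = (w a : MvPolynomial (Fin 4) ℝ)
  rw [← hW, eq_comm]
  fin_cases a <;> assumption

lemma range_twoFormParam_le (k : ℕ) :
    LinearMap.range (twoFormParam ((k : ℤ) - 1)) ≤ twoFormSpace k := by
  rintro _ ⟨⟨w, p⟩, rfl⟩
  rw [twoFormParam_apply]
  refine Submodule.add_mem_sup ⟨_, fun i _ => (w i).2, rfl⟩
    (Submodule.sum_mem _ fun i _ => Submodule.mem_iSup_of_mem i ⟨_, (p i).2, rfl⟩)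

/-- Rank-nullity for the parametrization, written additively to avoid natural subtraction. -/
lemma finrank_twoFormSpace_ge (n : ℕ) [FiniteDimensional ℝ (twoFormSpace (n + 1))] :
    6 * (n + 4).choose 4 + 4 * (n + 3).choose 3 ≤
      Module.finrank ℝ (twoFormSpace (n + 1)) + (n + 2).choose 3 := by
  have h1 := LinearMap.finrank_range_add_finrank_ker (twoFormParam n)
  have h2 : Module.finrank ℝ (LinearMap.range (twoFormParam n)) ≤
      Module.finrank ℝ (twoFormSpace (n + 1)) := by
    refine Submodule.finrank_mono ?_
    have := range_twoFormParam_le (n + 1)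
    rwa [Nat.cast_add, Nat.cast_one, add_sub_cancel_right] at this
  have h3 : Module.finrank ℝ (LinearMap.ker (twoFormParam n)) ≤
      Module.finrank ℝ (homogSpace 4 ((n : ℤ) - 1)) :=
    (Submodule.finrank_mono (ker_twoFormParam_le n)).trans (LinearMap.finrank_range_le _)
  have h4 := finrank_polySpace_sub (d := 4) (j := 0) (by omega) n
  have h5 := finrank_homogSpace_sub (d := 3) (j := 0) (by omega) n
  have h6 := finrank_homogSpace_sub (d := 3) (j := 1) (by omega) n
  rw [show (n : ℤ) - (0 : ℕ) = n by simp] at h4 h5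
  rw [show (n : ℤ) - (1 : ℕ) = n - 1 by simp] at h6
  simp only [Nat.sub_zero, Nat.reduceAdd, Nat.reduceSub] at h4 h5 h6
  rw [Module.finrank_prod, Module.finrank_pi_fintype, Module.finrank_pi_fintype] at h1
  simp only [h4, h5, Finset.sum_const, Finset.card_univ, Fintype.card_fin, smul_eq_mul] at h1
  rw [h6] at h3
  omega

/-- An increasing list is determined by its set of entries. An upper bound is enough, because the
dimension count squeezes. -/
lemma card_sub_le (d : ℕ) : Fintype.card (Sub d) ≤ Nat.choose 5 (d + 1) := by
  classical
  have h := Fintype.card_le_of_injective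
    (fun f : Sub d => (⟨Finset.univ.map f.toEmbedding, by
      simp [Finset.mem_powersetCard]⟩ :
        Finset.powersetCard (d + 1) (Finset.univ : Finset (Fin 5)))) ?_
  · simpa using h
  · intro f g hfg
    have h1 := congrArg (fun s : Finset (Fin 5) => (s : Set (Fin 5))) (congrArg Subtype.val hfg)
    simp only [Finset.coe_map, Finset.coe_univ, Set.image_univ,
      RelEmbedding.coe_toEmbedding] at h1
    exact DFunLike.coe_injective ((f.strictMono.range_inj g.strictMono).1 h1)

/-! ### The degrees of freedom as a linear map -/

/-- The codomain of the degrees of freedom. -/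
abbrev DofSpace (k : ℤ) : Type :=
  (Sub 2 → Module.Dual ℝ (polySpace 2 (k - 1))) ×
    (Sub 3 → Module.Dual ℝ (Fin 3 → polySpace 3 (k - 2))) ×
      Module.Dual ℝ (Fin 6 → polySpace 4 (k - 3))

lemma finrank_dofSpace_le (n : ℕ) : Module.finrank ℝ (DofSpace ((n + 1 : ℕ) : ℤ)) ≤
    10 * (n + 2).choose 2 + 15 * (n + 2).choose 3 + 6 * (n + 2).choose 4 := by
  have h2 := finrank_polySpace_sub (d := 2) (j := 0) (by omega) n
  have h3 := finrank_polySpace_sub (d := 3) (j := 1) (by omega) n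
  have h4 := finrank_polySpace_sub (d := 4) (j := 2) (by omega) n
  rw [show (n : ℤ) - (0 : ℕ) = ((n + 1 : ℕ) : ℤ) - 1 by push_cast; ring] at h2
  rw [show (n : ℤ) - (1 : ℕ) = ((n + 1 : ℕ) : ℤ) - 2 by push_cast; ring] at h3
  rw [show (n : ℤ) - (2 : ℕ) = ((n + 1 : ℕ) : ℤ) - 3 by push_cast; ring] at h4
  have c2 : Fintype.card (Sub 2) ≤ 10 := card_sub_le 2
  have c3 : Fintype.card (Sub 3) ≤ 5 := card_sub_le 3
  simp only [DofSpace, Module.finrank_prod, Module.finrank_pi_fintype, Subspace.dual_finrank_eq,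
    h2, h3, h4, Finset.sum_const, Finset.card_univ, Fintype.card_fin, smul_eq_mul]
  simp only [Nat.sub_zero, Nat.reduceSub]
  nlinarith [Nat.mul_le_mul_right ((n + 2).choose 2) c2,
    Nat.mul_le_mul_right (3 * (n + 2).choose 3) c3]

variable {v : Fin 5 → Fin 4 → ℝ} {k : ℕ}

lemma skew_of_mem_twoFormSpace {F : MatrixField} (hF : F ∈ twoFormSpace k) (i j : Fin 4) :
    F i j = -F j i :=
  (twoFormSpace_le_trimmedSpace k hF).skew i j

/-- The face moments, as a bilinear map. -/
def faceDof (hv : AffineIndependent ℝ v) (N : UnitNormals v) (k : ℕ) (f : Sub 2) :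
    twoFormSpace k →ₗ[ℝ] Module.Dual ℝ (polySpace 2 ((k : ℤ) - 1)) :=
  LinearMap.mk₂ ℝ (fun F q => faceMoment N f F q)
    (by
      obtain ⟨c, -, h⟩ := exists_faceMoment_eq hv N f
      intro F G q
      rw [h _ (skew_of_mem_twoFormSpace F.2), h _ (skew_of_mem_twoFormSpace G.2),
        h _ (skew_of_mem_twoFormSpace (F + G).2), Submodule.coe_add, map_add, Matrix.add_apply,
        add_mul, map_add, mul_add])
    (by
      obtain ⟨c, -, h⟩ := exists_faceMoment_eq hv N f
      intro a F q
      rw [h _ (skew_of_mem_twoFormSpace F.2), h _ (skew_of_mem_twoFormSpace (a • F).2),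
        Submodule.coe_smul, map_smul, Matrix.smul_apply, smul_mul_assoc, map_smul, smul_eq_mul,
        smul_eq_mul, mul_left_comm])
    (by
      obtain ⟨c, -, h⟩ := exists_faceMoment_eq hv N f
      intro F q r
      simp only [h _ (skew_of_mem_twoFormSpace F.2), Submodule.coe_add, mul_add, map_add])
    (by
      obtain ⟨c, -, h⟩ := exists_faceMoment_eq hv N f
      intro a F q
      simp only [h _ (skew_of_mem_twoFormSpace F.2), Submodule.coe_smul, mul_smul_comm, map_smul,
        smul_eq_mul, mul_left_comm])

lemma twoFormVec_add (G H : Matrix (Fin 3) (Fin 3) (MvPolynomial (Fin 3) ℝ)) (b : Fin 3) :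
    twoFormVec (G + H) b = twoFormVec G b + twoFormVec H b := by
  fin_cases b <;> rfl

lemma twoFormVec_smul (a : ℝ) (G : Matrix (Fin 3) (Fin 3) (MvPolynomial (Fin 3) ℝ)) (b : Fin 3) :
    twoFormVec (a • G) b = a • twoFormVec G b := by
  fin_cases b <;> rfl

/-- The facet moments, as a bilinear map. -/
def facetDof (hv : AffineIndependent ℝ v) (N : UnitNormals v) (k : ℕ) (𝓕 : Sub 3) :
    twoFormSpace k →ₗ[ℝ] Module.Dual ℝ (Fin 3 → polySpace 3 ((k : ℤ) - 2)) :=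
  LinearMap.mk₂ ℝ (fun F q => facetMoment N 𝓕 F fun a => q a)
    (by
      obtain ⟨c, -, h⟩ := exists_facetMoment_eq hv N 𝓕
      intro F G q
      rw [h _ (skew_of_mem_twoFormSpace F.2), h _ (skew_of_mem_twoFormSpace G.2),
        h _ (skew_of_mem_twoFormSpace (F + G).2), Submodule.coe_add, map_add]
      simp only [twoFormVec_add, add_mul, Finset.sum_add_distrib, map_add, mul_add])
    (by
      obtain ⟨c, -, h⟩ := exists_facetMoment_eq hv N 𝓕
      intro a F q
      rw [h _ (skew_of_mem_twoFormSpace F.2), h _ (skew_of_mem_twoFormSpace (a • F).2),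
        Submodule.coe_smul, map_smul]
      simp only [twoFormVec_smul, smul_mul_assoc, ← Finset.smul_sum, map_smul, smul_eq_mul,
        mul_left_comm])
    (by
      obtain ⟨c, -, h⟩ := exists_facetMoment_eq hv N 𝓕
      intro F q r
      simp only [h _ (skew_of_mem_twoFormSpace F.2), Pi.add_apply, Submodule.coe_add, smul_add,
        Finset.sum_add_distrib, mul_add, map_add])
    (by
      obtain ⟨c, -, h⟩ := exists_facetMoment_eq hv N 𝓕
      intro a F q
      simp only [h _ (skew_of_mem_twoFormSpace F.2), Pi.smul_apply, Submodule.coe_smul,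
        smul_comm _ a, ← Finset.smul_sum, mul_smul_comm, map_smul, smul_eq_mul, mul_left_comm])

/-- The volume moments, as a bilinear map. -/
def volumeDof (hv : AffineIndependent ℝ v) (k : ℕ) :
    twoFormSpace k →ₗ[ℝ] Module.Dual ℝ (Fin 6 → polySpace 4 ((k : ℤ) - 3)) :=
  LinearMap.mk₂ ℝ (fun F w => volumeMoment v F fun a => w a)
    (by
      obtain ⟨c, -, h⟩ := exists_volumeMoment_eq hv
      intro F G w
      simp only [h, Submodule.coe_add, Matrix.add_apply, add_mul, Finset.sum_add_distrib, map_add,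
        mul_add])
    (by
      obtain ⟨c, -, h⟩ := exists_volumeMoment_eq hv
      intro a F w
      simp only [h, Submodule.coe_smul, Matrix.smul_apply, smul_mul_assoc, ← Finset.smul_sum,
        map_smul, smul_eq_mul, mul_left_comm])
    (by
      obtain ⟨c, -, h⟩ := exists_volumeMoment_eq hv
      intro F w z
      have hwz : (fun a => ((w + z) a : MvPolynomial (Fin 4) ℝ)) =
        (fun a => (w a : MvPolynomial (Fin 4) ℝ)) + fun a => (z a : MvPolynomial (Fin 4) ℝ) := rfl
      rw [hwz, h, h, h, map_add]
      simp only [Matrix.add_apply, mul_add, Finset.sum_add_distrib, map_add])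
    (by
      obtain ⟨c, -, h⟩ := exists_volumeMoment_eq hv
      intro a F w
      have haw : (fun b => ((a • w) b : MvPolynomial (Fin 4) ℝ)) =
        a • fun b => (w b : MvPolynomial (Fin 4) ℝ) := rfl
      rw [haw, h, h, map_smul]
      simp only [Matrix.smul_apply, mul_smul_comm, ← Finset.smul_sum, map_smul, smul_eq_mul,
        mul_left_comm])

/-- All degrees of freedom, as a linear map. -/
def dofMap (hv : AffineIndependent ℝ v) (N : UnitNormals v) (k : ℕ) :
    twoFormSpace k →ₗ[ℝ] DofSpace (k : ℤ) :=
  (LinearMap.pi (faceDof hv N k)).prod ((LinearMap.pi (facetDof hv N k)).prod (volumeDof hv k))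

lemma dofMap_eq_iff (hv : AffineIndependent ℝ v) (N : UnitNormals v) (F : twoFormSpace k)
    (α : Sub 2 → Module.Dual ℝ (polySpace 2 ((k : ℤ) - 1)))
    (β : Sub 3 → Module.Dual ℝ (Fin 3 → polySpace 3 ((k : ℤ) - 2)))
    (γ : Module.Dual ℝ (Fin 6 → polySpace 4 ((k : ℤ) - 3))) :
    dofMap hv N k F = (α, β, γ) ↔
      (∀ f (q : polySpace 2 ((k : ℤ) - 1)), faceMoment N f F q = α f q) ∧
        (∀ 𝓕 q, facetMoment N 𝓕 F (fun a => q a) = β 𝓕 q) ∧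
        (∀ w, volumeMoment v F (fun a => w a) = γ w) := by
  have h : dofMap hv N k F =
    (fun f => faceDof hv N k f F, fun 𝓕 => facetDof hv N k 𝓕 F, volumeDof hv k F) := rfl
  rw [h, Prod.mk.injEq, Prod.mk.injEq, funext_iff, funext_iff]
  simp only [LinearMap.ext_iff]
  rfl

lemma dofMap_injective (hv : AffineIndependent ℝ v) (N : UnitNormals v) (k : ℕ) :
    Function.Injective (dofMap hv N k) := by
  refine (injective_iff_map_eq_zero _).2 fun F hF => Subtype.ext ?_
  obtain ⟨h1, h2, h3⟩ := (dofMap_eq_iff hv N F 0 0 0).1 hF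
  exact (twoFormSpace_le_trimmedSpace k F.2).eq_zero_of_moments hv N
    (fun f q hq => h1 f ⟨q, hq⟩) (fun 𝓕 q hq => h2 𝓕 fun a => ⟨q a, hq a⟩)
    (fun w hw => h3 fun a => ⟨w a, hw a⟩)

/-- Injectivity places the dimension of the form space between the Koszul lower bound and the upper
bound for the number of moments. These coincide, so the map is also onto. -/
lemma dofMap_bijective (hv : AffineIndependent ℝ v) (N : UnitNormals v) (hk : 1 ≤ k) :
    Function.Bijective (dofMap hv N k) := by
  have hinj := dofMap_injective hv N k
  obtain ⟨n, rfl⟩ := Nat.exists_eq_add_of_le' hk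
  have : FiniteDimensional ℝ (twoFormSpace (n + 1)) := FiniteDimensional.of_injective _ hinj
  have h1 := finrank_twoFormSpace_ge n
  have h2 := finrank_dofSpace_le n
  have h3 := LinearMap.finrank_le_finrank_of_injective hinj
  have h4 : Module.finrank ℝ (twoFormSpace (n + 1)) =
      Module.finrank ℝ (DofSpace ((n + 1 : ℕ) : ℤ)) := by
    -- With $n=k-1$, Pascal's rule reduces both bounds to
    -- $10\binom{n+2}{2}+15\binom{n+2}{3}+6\binom{n+2}{4}$.
    have e1 := Nat.choose_succ_succ' (n + 3) 3
    have e2 := Nat.choose_succ_succ' (n + 2) 3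
    have e3 := Nat.choose_succ_succ' (n + 2) 2
    simp only [Nat.add_assoc, Nat.reduceAdd] at e1 e2 e3
    omega
  exact ⟨hinj, (LinearMap.injective_iff_surjective_of_finrank_eq_finrank h4).1 hinj⟩

end

end Pentatope

open Pentatope in
theorem mainTheorem2 (k : ℕ) (hk : 1 ≤ k) (v : Fin 5 → Fin 4 → ℝ)
    (hv : AffineIndependent ℝ v) (N : UnitNormals v) :
    (∀ F ∈ twoFormSpace k,
      (∀ f : Sub 2, ∀ q ∈ polySpace 2 ((k : ℤ) - 1), faceMoment N f F q = 0) →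
      (∀ 𝓕 : Sub 3, ∀ q : Fin 3 → MvPolynomial (Fin 3) ℝ,
        (∀ a, q a ∈ polySpace 3 ((k : ℤ) - 2)) → facetMoment N 𝓕 F q = 0) →
      (∀ w : Fin 6 → MvPolynomial (Fin 4) ℝ,
        (∀ a, w a ∈ polySpace 4 ((k : ℤ) - 3)) → volumeMoment v F w = 0) →
      F = 0) ∧
    (∀ (α : Sub 2 → Module.Dual ℝ (polySpace 2 ((k : ℤ) - 1)))
      (β : Sub 3 → Module.Dual ℝ (Fin 3 → polySpace 3 ((k : ℤ) - 2)))
      (γ : Module.Dual ℝ (Fin 6 → polySpace 4 ((k : ℤ) - 3))),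
      ∃! F : MatrixField, F ∈ twoFormSpace k ∧
        (∀ f (q : polySpace 2 ((k : ℤ) - 1)), faceMoment N f F q = α f q) ∧
        (∀ 𝓕 q, facetMoment N 𝓕 F (fun a => q a) = β 𝓕 q) ∧
        (∀ w, volumeMoment v F (fun a => w a) = γ w)) := by
  refine ⟨fun F hF h1 h2 h3 => (twoFormSpace_le_trimmedSpace k hF).eq_zero_of_moments hv N h1 h2 h3,
    fun α β γ => ?_⟩
  obtain ⟨hinj, hsurj⟩ := dofMap_bijective hv N hk
  obtain ⟨F, hF⟩ := hsurj (α, β, γ)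
  refine ⟨F, ⟨F.2, (dofMap_eq_iff hv N F α β γ).1 hF⟩, fun G hG => ?_⟩
  have h := (dofMap_eq_iff hv N ⟨G, hG.1⟩ α β γ).2 hG.2
  exact congrArg Subtype.val (hinj (h.trans hF.symm))
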